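/- \textbf{Setting.} Let $m,n\in\mathbb N$ and let $A\in\mathbb R^{m\times n}$ (a matrix of $m$ linear queries). Datasets $x,x'\in\mathbb R^n$ are neighboring if $\|x-x'\|_1\le 1$. A mechanism $\mathcal M:\mathbb R^n\to\mathbb R^m$ assigns to every $x$ a random vector $\mathcal M(x)$; it is $(\varepsilon,\delta)$-DP if $\Pr[\mathcal M(x)\in S]\le e^{\varepsilon}\Pr[\mathcal M(x')\in S]+\delta$ for all neighboring $x,x'$ and all measurable $S$. For real $p\ge 2$ put $$\mathrm{err}_p(\mathcal M,A)=\sup_{x\in\mathbb R^n}\bigl(\mathbb E\|\mathcal M(x)-Ax\|_p^p\bigr)^{1/p}\in[0,\infty],\qquad \gamma_{(p)}(A)=\min_{A=LR}\Bigl(\sum_{i=1}^m (LL^\top)_{ii}^{p/2}\Bigr)^{1/p}\|R\|_{1\to 2},$$ where the minimum is over all $k$, $L\in\mathbb R^{m\times k}$, $R\in\mathbb R^{k\times n}$ with $LR=A$, and $\|R\|_{1\to2}=\max_{\|x\|_1\le1}\|Rx\|_2$. \textbf{Theorem.} There is a universal constant $C>0$ such that the following hold. 1. (Lower bound.) Let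 $m,n\in\mathbb N$, $A\in\mathbb R^{m\times n}$, $p\in[2,\infty)$, $0<\varepsilon<\tfrac12$ and $0\le\delta\le1$. Every $(\varepsilon,\delta)$-DP mechanism $\mathcal M:\mathbb R^n\to\mathbb R^m$ satisfies $$\mathrm{err}_p(\mathcal M,A)\ \ge\ \frac{(1-\tilde\delta)\,\gamma_{(p)}(A)}{C\varepsilon},\qquad \tilde\delta=\frac{2e^{2\varepsilon}(e^{1/2}-1)}{e^{\varepsilon}-1}\,\delta .$$ 2. (Matrix mechanism and its optimality.) For all $0<\varepsilon<1$ and $0<\delta\le\tfrac12$ there is $c=c(\varepsilon,\delta)>0$ such that for all $m,n\in\mathbb N$, $A\in\mathbb R^{m\times n}$ and $p\in[2,\infty)$ there are $k$ and a factorization $A=LR$ with $L\in\mathbb R^{m\times k}$, $R\in\mathbb R^{k\times n}$ for which the mechanism $\mathcal M_{\mathrm{matrix}}(x)=L(Rx+z)$, $z\sim\mathcal N(0,c^2\|R\|_{1\to2}^2 I_k)$, is $(\varepsilon,\delta)$-DP, satisfies $$\mathrm{err}_p(\mathcal M_{\mathrm{matrix}},A)\ \le\ 3\,\gamma_{(p)}(A)\sqrt{\frac{p\,\log(1/\delta)}{2\varepsilon^2}},$$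 and, for every $(\varepsilon,\delta)$-DP mechanism $\mathcal M:\mathbb R^n\to\mathbb R^m$, $$\mathrm{err}_p(\mathcal M_{\mathrm{matrix}},A)\ \le\ C\sqrt{p\,\log(1/\delta)}\;\mathrm{err}_p(\mathcal M,A).$$ -/

import Mathlib

open MeasureTheory ProbabilityTheory Matrix
open scoped ENNReal NNReal

noncomputable section

/-- A randomized algorithm `ℝⁿ → ℝᵐ`, given by the law of its output on every input. No regularity
in the input is required. -/
abbrev Mechanism (n m : ℕ) : Type :=
  (Fin n → ℝ) → ProbabilityMeasure (Fin m → ℝ)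

/-- Datasets `x, x' ∈ ℝⁿ` are neighboring if `‖x - x'‖₁ ≤ 1`. -/
def Neighboring {n : ℕ} (x x' : Fin n → ℝ) : Prop :=
  ∑ j, |x j - x' j| ≤ 1

/-- `(ε, δ)`-differential privacy:
`Pr[M(x) ∈ S] ≤ e^ε Pr[M(x') ∈ S] + δ` for all neighboring `x, x'` and all measurable `S`. -/
def IsDP {n m : ℕ} (ε δ : ℝ) (M : Mechanism n m) : Prop :=
  ∀ x x' : Fin n → ℝ, Neighboring x x' → ∀ S : Set (Fin m → ℝ), MeasurableSet S →
    (M x : Measure (Fin m → ℝ)) S ≤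
      ENNReal.ofReal (Real.exp ε) * (M x' : Measure (Fin m → ℝ)) S + ENNReal.ofReal δ

/-- The worst-case error `sup_x (E ‖M(x) - A x‖_p^p)^(1/p)`, as an extended nonnegative real: it is
`∞` if some of the moments are infinite or if they are unbounded in `x`. -/
def lpError {n m : ℕ} (p : ℝ) (M : Mechanism n m) (A : Matrix (Fin m) (Fin n) ℝ) : ℝ≥0∞ :=
  ⨆ x : Fin n → ℝ,
    (∫⁻ y, ENNReal.ofReal (∑ i, |y i - (A *ᵥ x) i| ^ p) ∂(M x : Measure (Fin m → ℝ))) ^ (1 / p)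

/-- The operator norm `‖R‖_{1→2} = max {‖R x‖₂ : ‖x‖₁ ≤ 1}`. -/
def oneTwoNorm {k n : ℕ} (R : Matrix (Fin k) (Fin n) ℝ) : ℝ :=
  sSup {r : ℝ | ∃ x : Fin n → ℝ, ∑ j, |x j| ≤ 1 ∧ r = Real.sqrt (∑ i, (R *ᵥ x) i ^ 2)}

/-- The `q`-trace `(∑ i, U i i ^ q)^(1/q)` of a positive semidefinite matrix, for `q < ∞`. -/
def pTrace {d : ℕ} (q : ℝ) (U : Matrix (Fin d) (Fin d) ℝ) : ℝ :=
  (∑ i, U i i ^ q) ^ (1 / q)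

/-- The factorization norm `γ_(p)(A)`: the least value of `√(tr_{p/2}(L Lᵀ)) * ‖R‖_{1→2}` over all
factorizations `A = L R` with any inner dimension `k`. -/
def gammaNorm {m n : ℕ} (p : ℝ) (A : Matrix (Fin m) (Fin n) ℝ) : ℝ :=
  sInf {r : ℝ | ∃ (k : ℕ) (L : Matrix (Fin m) (Fin k) ℝ) (R : Matrix (Fin k) (Fin n) ℝ),
    L * R = A ∧ r = Real.sqrt (pTrace (p / 2) (L * Lᵀ)) * oneTwoNorm R}

/-- The law `N(0, σ² I_k)` of a vector of `k` independent centered Gaussians of variance `σ²`. -/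
def gaussianVector (k : ℕ) (σ : ℝ) : Measure (Fin k → ℝ) :=
  Measure.pi fun _ => gaussianReal 0 (Real.toNNReal (σ ^ 2))

instance (k : ℕ) (σ : ℝ) : IsProbabilityMeasure (gaussianVector k σ) := by
  unfold gaussianVector; infer_instance

/-- The matrix mechanism `x ↦ L (R x + z)` with `z ∼ N(0, σ² I_k)`. -/
def matrixMechanism {m k n : ℕ} (L : Matrix (Fin m) (Fin k) ℝ) (R : Matrix (Fin k) (Fin n) ℝ)
    (σ : ℝ) : Mechanism n m := fun x =>
  ⟨(gaussianVector k σ).map fun z => L *ᵥ (R *ᵥ x + z),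
    Measure.isProbabilityMeasure_map
      (Continuous.aemeasurable
        (Continuous.matrix_mulVec continuous_const (continuous_const.add continuous_id)))⟩

/-- The quantity `δ̃ = 2 e^{2ε} (e^{1/2} - 1) / (e^ε - 1) * δ` in the lower bound. -/
def deltaTilde (ε δ : ℝ) : ℝ :=
  2 * Real.exp (2 * ε) * (Real.exp (1 / 2) - 1) / (Real.exp ε - 1) * δ

end

/-! Lower bound. Privacy forces the error to have a large second moment along every column `a` of
`A`: inputs `x` and `x ± k e_j` are hard to tell apart by group privacy, yet their answers differ by
`k a`, so in any direction `θ` the errors at the two inputs cannot both be small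
(`secondMoment_add_ge`). A single law has to serve all columns at once, so the error is averaged
over the cube `{0, k}ⁿ`, which every coordinate flip preserves (`secondMoment_cubeError_ge`). The
second moment matrix `U` of this average dominates `β a aᵀ` for every column, with `β` of order
`k²`. Such a domination is a factorization in disguise: `U = L Lᵀ` and `A = L R` with columns of `R`
of length at most `1/√β` (`gammaNorm_le_of_posSemidef`). Jensen bounds the diagonal of `U` by the
`p`-th moments, so `γ_(p)(A)` is at most the error divided by `√β`.

Upper bound. Gaussian noise of scale `2 √(log (1/δ)) / max ε δ` times `‖R‖_{1→2}` is private, and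
the `p`-th moments of its image under `L` give an error of at most `√p` times that scale times
`√(tr_{p/2}(L Lᵀ))`.

The maximum is what makes the optimality constant universal. When `δ > ε`, group privacy only
reaches size about `1/δ`, so the available lower bound is `γ / max ε δ`. The noise has to shrink
accordingly, and in that regime even `(0, δ)`-privacy holds. -/

/-! ### Exponential moments and shifts of Gaussian vectors. -/

theorem dotProduct_self_real_nonneg {ι : Type*} [Fintype ι] (w : ι → ℝ) : 0 ≤ w ⬝ᵥ w :=
  Finset.sum_nonneg fun i _ => mul_self_nonneg (w i)

theorem integrable_exp_dotProduct_gaussianVector {k : ℕ} (σ : ℝ) (w : Fin k → ℝ) :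
    Integrable (fun z => Real.exp (w ⬝ᵥ z)) (gaussianVector k σ) := by
  have h : (fun z : Fin k → ℝ => Real.exp (w ⬝ᵥ z)) =
      fun z => ∏ i, (fun x : ℝ => Real.exp (w i * x)) (z i) := by
    funext z
    simp [dotProduct, Real.exp_sum]
  rw [h]
  exact Integrable.fintype_prod (f := fun i (x : ℝ) => Real.exp (w i * x))
    fun i => integrable_exp_mul_gaussianReal (w i)

theorem integral_exp_dotProduct_gaussianVector {k : ℕ} (σ : ℝ) (w : Fin k → ℝ) :
    ∫ z, Real.exp (w ⬝ᵥ z) ∂(gaussianVector k σ) = Real.exp (σ ^ 2 * (w ⬝ᵥ w) / 2) := by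
  have h : (fun z : Fin k → ℝ => Real.exp (w ⬝ᵥ z)) =
      fun z => ∏ i, (fun x : ℝ => Real.exp (w i * x)) (z i) := by
    funext z
    simp [dotProduct, Real.exp_sum]
  rw [h, gaussianVector, integral_fintype_prod_eq_prod (f := fun i (x : ℝ) => Real.exp (w i * x))]
  have h1 (i : Fin k) : ∫ x, Real.exp (w i * x) ∂(gaussianReal 0 (Real.toNNReal (σ ^ 2))) =
      Real.exp (σ ^ 2 * (w i * w i) / 2) := by
    have := congrFun (mgf_fun_id_gaussianReal (μ := 0) (v := Real.toNNReal (σ ^ 2))) (w i)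
    rw [mgf] at this
    rw [this, Real.coe_toNNReal _ (sq_nonneg σ)]
    ring_nf
  simp_rw [h1]
  rw [← Real.exp_sum, dotProduct, Finset.mul_sum, Finset.sum_div]

/-- The density of `N(v, σ² I)` with respect to `N(0, σ² I)`. -/
noncomputable def shiftDensity {k : ℕ} (σ : ℝ) (v z : Fin k → ℝ) : ℝ :=
  Real.exp (v ⬝ᵥ z / σ ^ 2 - v ⬝ᵥ v / (2 * σ ^ 2))

theorem shiftDensity_pos {k : ℕ} (σ : ℝ) (v z : Fin k → ℝ) : 0 < shiftDensity σ v z :=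
  Real.exp_pos _

theorem shiftDensity_rpow {k : ℕ} (σ : ℝ) (v z : Fin k → ℝ) (s : ℝ) :
    shiftDensity σ v z ^ s =
      Real.exp (-(s * (v ⬝ᵥ v / (2 * σ ^ 2)))) * Real.exp (((s / σ ^ 2) • v) ⬝ᵥ z) := by
  rw [shiftDensity, ← Real.exp_mul, ← Real.exp_add, smul_dotProduct, smul_eq_mul]
  ring_nf

theorem integrable_shiftDensity_rpow {k : ℕ} (σ : ℝ) (v : Fin k → ℝ) (s : ℝ) :
    Integrable (fun z => shiftDensity σ v z ^ s) (gaussianVector k σ) := by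
  simp_rw [shiftDensity_rpow]
  exact (integrable_exp_dotProduct_gaussianVector σ _).const_mul _

/-- A power of the density is again the exponential of an affine function, so all Rényi-type moments
come from the Gaussian moment generating function. They control both privacy regimes. -/
theorem integral_shiftDensity_rpow {k : ℕ} {σ : ℝ} (hσ : 0 < σ) (v : Fin k → ℝ) (s : ℝ) :
    ∫ z, shiftDensity σ v z ^ s ∂(gaussianVector k σ) =
      Real.exp (s * (s - 1) * (v ⬝ᵥ v / σ ^ 2) / 2) := by
  simp_rw [shiftDensity_rpow]
  rw [integral_const_mul, integral_exp_dotProduct_gaussianVector, ← Real.exp_add,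
    smul_dotProduct, dotProduct_smul, smul_eq_mul, smul_eq_mul]
  congr 1
  field_simp
  ring

theorem gaussianReal_eq_withDensity {σ : ℝ} (hσ : 0 < σ) (a : ℝ) :
    gaussianReal a (Real.toNNReal (σ ^ 2)) =
      (gaussianReal 0 (Real.toNNReal (σ ^ 2))).withDensity
        fun x => ENNReal.ofReal (Real.exp (a * x / σ ^ 2 - a * a / (2 * σ ^ 2))) := by
  have hv : Real.toNNReal (σ ^ 2) ≠ 0 := by simpa using hσ.ne'
  rw [gaussianReal_of_var_ne_zero _ hv, gaussianReal_of_var_ne_zero _ hv,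
    ← withDensity_mul _ (measurable_gaussianPDF _ _) (by fun_prop)]
  congr 1
  funext x
  rw [Pi.mul_apply, gaussianPDF, gaussianPDF, ← ENNReal.ofReal_mul (gaussianPDFReal_nonneg _ _ _),
    gaussianPDFReal, gaussianPDFReal, mul_assoc (√_)⁻¹, ← Real.exp_add,
    Real.coe_toNNReal _ (sq_nonneg σ)]
  congr 3
  field_simp
  ring

/-- The density factors over coordinates, so it suffices to compare both measures on boxes. There
Fubini for products of real integrals reduces the claim to one dimension. -/
theorem gaussianVector_map_add {k : ℕ} {σ : ℝ} (hσ : 0 < σ) (v : Fin k → ℝ) :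
    (gaussianVector k σ).map (fun z => v + z) =
      (gaussianVector k σ).withDensity fun z => ENNReal.ofReal (shiftDensity σ v z) := by
  have h1 : (gaussianVector k σ).map (fun z => v + z) =
      Measure.pi fun i => gaussianReal (v i) (Real.toNNReal (σ ^ 2)) := by
    have := Measure.pi_map_pi (μ := fun _ : Fin k => gaussianReal 0 (Real.toNNReal (σ ^ 2)))
      (f := fun i (x : ℝ) => v i + x) (fun i => by fun_prop)
    simp_rw [gaussianReal_map_const_add, zero_add] at this
    exact this
  rw [h1]
  refine Measure.pi_eq fun s hs => ?_
  let g : Fin k → ℝ → ℝ := fun i =>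
    (s i).indicator fun x => Real.exp (v i * x / σ ^ 2 - v i * v i / (2 * σ ^ 2))
  have hint (i : Fin k) : Integrable (fun x : ℝ =>
      Real.exp (v i * x / σ ^ 2 - v i * v i / (2 * σ ^ 2)))
      (gaussianReal 0 (Real.toNNReal (σ ^ 2))) := by
    have := (integrable_exp_mul_gaussianReal (μ := 0) (v := Real.toNNReal (σ ^ 2))
      (v i / σ ^ 2)).const_mul (Real.exp (-(v i * v i / (2 * σ ^ 2))))
    refine this.congr (ae_of_all _ fun x => ?_)
    simp only
    rw [← Real.exp_add]
    ring_nf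
  have hg (i : Fin k) : Integrable (g i) (gaussianReal 0 (Real.toNNReal (σ ^ 2))) :=
    (hint i).indicator (hs i)
  have hg0 (i : Fin k) (x : ℝ) : 0 ≤ g i x :=
    Set.indicator_nonneg (fun _ _ => (Real.exp_pos _).le) _
  have hpt (z : Fin k → ℝ) : (Set.univ.pi s).indicator (fun z => shiftDensity σ v z) z =
      ∏ i, g i (z i) := by
    by_cases hz : z ∈ Set.univ.pi s
    · rw [Set.indicator_of_mem hz, shiftDensity, dotProduct, dotProduct, Finset.sum_div,
        Finset.sum_div, ← Finset.sum_sub_distrib, Real.exp_sum]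
      exact Finset.prod_congr rfl fun i _ => by
        simp only [g]
        rw [Set.indicator_of_mem (hz i trivial)]
    · rw [Set.indicator_of_notMem hz]
      simp only [Set.mem_pi, Set.mem_univ, true_imp_iff, not_forall] at hz
      obtain ⟨i, hi⟩ := hz
      exact (Finset.prod_eq_zero (Finset.mem_univ i) (Set.indicator_of_notMem hi _)).symm
  have hfac (i : Fin k) : gaussianReal (v i) (Real.toNNReal (σ ^ 2)) (s i) =
      ENNReal.ofReal (∫ x, g i x ∂(gaussianReal 0 (Real.toNNReal (σ ^ 2)))) := by
    rw [gaussianReal_eq_withDensity hσ, withDensity_apply _ (hs i), integral_indicator (hs i),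
      ofReal_integral_eq_lintegral_ofReal (hint i).integrableOn
        (ae_of_all _ fun _ => (Real.exp_pos _).le)]
  simp_rw [hfac]
  rw [← ENNReal.ofReal_prod_of_nonneg fun i _ => integral_nonneg (hg0 i),
    ← integral_fintype_prod_eq_prod (f := g)]
  rw [withDensity_apply _ (.univ_pi hs), ← lintegral_indicator (.univ_pi hs)]
  rw [ofReal_integral_eq_lintegral_ofReal (Integrable.fintype_prod hg)
    (ae_of_all _ fun z => Finset.prod_nonneg fun i _ => hg0 i (z i))]
  refine lintegral_congr fun z => ?_
  rw [← hpt]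
  by_cases hz : z ∈ Set.univ.pi s
  · simp [Set.indicator_of_mem hz]
  · simp [Set.indicator_of_notMem hz]

/-! ### Privacy of the Gaussian mechanism in the two regimes. -/

/-- If the shift density is at most `a + h` with `∫ h ≤ δ`, the shifted and the centered Gaussian
satisfy the privacy inequality with multiplicative constant `a`. -/
theorem gaussianVector_shift_le {k : ℕ} {σ a δ : ℝ} (hσ : 0 < σ) (ha : 0 ≤ a) (v : Fin k → ℝ)
    (h : (Fin k → ℝ) → ℝ) (h0 : ∀ z, 0 ≤ h z) (hi : Integrable h (gaussianVector k σ))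
    (hle : ∀ z, shiftDensity σ v z ≤ a + h z)
    (hδ : ∫ z, h z ∂(gaussianVector k σ) ≤ δ) {S : Set (Fin k → ℝ)} (hS : MeasurableSet S) :
    (gaussianVector k σ).map (fun z => v + z) S ≤
      ENNReal.ofReal a * gaussianVector k σ S + ENNReal.ofReal δ := by
  rw [gaussianVector_map_add hσ, withDensity_apply _ hS]
  calc ∫⁻ z in S, ENNReal.ofReal (shiftDensity σ v z) ∂(gaussianVector k σ)
      ≤ ∫⁻ z in S, (ENNReal.ofReal a + ENNReal.ofReal (h z)) ∂(gaussianVector k σ) :=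
        lintegral_mono fun z => by
          rw [← ENNReal.ofReal_add ha (h0 z)]
          exact ENNReal.ofReal_le_ofReal (hle z)
    _ = ENNReal.ofReal a * gaussianVector k σ S +
          ∫⁻ z in S, ENNReal.ofReal (h z) ∂(gaussianVector k σ) := by
        rw [lintegral_add_left measurable_const, lintegral_const, Measure.restrict_apply_univ]
    _ ≤ _ := by
        gcongr
        refine (setLIntegral_le_lintegral _ _).trans ?_
        rw [← ofReal_integral_eq_lintegral_ofReal hi (ae_of_all _ h0)]
        exact ENNReal.ofReal_le_ofReal hδ

/-- Gaussian mechanism, `δ ≤ ε`: noise of standard deviation `2 √(log (1/δ)) / ε` times the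
sensitivity is private. -/
theorem gaussianVector_shift_le_of_le {k : ℕ} {σ ε δ : ℝ} (hσ : 0 < σ) (hε : 0 < ε) (hε1 : ε < 1)
    (hδ : 0 < δ) (hδ2 : δ ≤ 1 / 2) (v : Fin k → ℝ)
    (hv : v ⬝ᵥ v / σ ^ 2 ≤ ε ^ 2 / (4 * Real.log (1 / δ))) {S : Set (Fin k → ℝ)}
    (hS : MeasurableSet S) :
    (gaussianVector k σ).map (fun z => v + z) S ≤
      ENNReal.ofReal (Real.exp ε) * gaussianVector k σ S + ENNReal.ofReal δ := by
  set l := Real.log (1 / δ) with hl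
  have hl0 : 0 < l := Real.log_pos (by rw [lt_div_iff₀ hδ]; linarith)
  -- Chernoff bound: where the density `f` exceeds `e^ε`, it is at most `e^(-sε) f^(s+1)`. With this
  -- `s` the integral of that excess has exponent at most `-4l + 2l + ε/2`, hence is at most `δ²
  -- e^(1/2) ≤ 2δ² ≤ δ`.
  set s := 4 * l / ε with hs
  have hs0 : 0 < s := by positivity
  refine gaussianVector_shift_le hσ (Real.exp_pos ε).le v
    (fun z => Real.exp (-(s * ε)) * shiftDensity σ v z ^ (s + 1))
    (fun z => by have := shiftDensity_pos σ v z; positivity)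
    ((integrable_shiftDensity_rpow σ v (s + 1)).const_mul _)
    (fun z => ?_) ?_ hS
  · have hr := shiftDensity_pos σ v z
    rcases le_total (shiftDensity σ v z) (Real.exp ε) with h | h
    · have : 0 ≤ Real.exp (-(s * ε)) * shiftDensity σ v z ^ (s + 1) := by positivity
      linarith
    · have h1 : 1 ≤ Real.exp (-(s * ε)) * shiftDensity σ v z ^ s := by
        have := Real.rpow_le_rpow (Real.exp_pos ε).le h hs0.le
        calc (1 : ℝ) = Real.exp (-(s * ε)) * Real.exp ε ^ s := by
              rw [← Real.exp_mul, ← Real.exp_add, mul_comm ε s]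
              simp
          _ ≤ _ := by gcongr
      rw [Real.rpow_add hr, Real.rpow_one, ← mul_assoc]
      have := (Real.exp_pos ε).le
      nlinarith
  · rw [integral_const_mul, integral_shiftDensity_rpow hσ, ← Real.exp_add]
    have h1 : -(s * ε) + (s + 1) * (s + 1 - 1) * (v ⬝ᵥ v / σ ^ 2) / 2 ≤ -(2 * l) + 1 / 2 := by
      have : (s + 1) * s * (v ⬝ᵥ v / σ ^ 2) / 2 ≤ (s + 1) * s * (ε ^ 2 / (4 * l)) / 2 := by
        gcongr
      have e : (s + 1) * s * (ε ^ 2 / (4 * l)) / 2 = 2 * l + ε / 2 := by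
        rw [hs]; field_simp; ring
      have e2 : s * ε = 4 * l := by rw [hs]; field_simp
      rw [add_sub_cancel_right, e2]
      linarith
    refine (Real.exp_le_exp.2 h1).trans ?_
    have hexp : Real.exp (-l) = δ := by
      rw [hl, one_div, Real.log_inv, neg_neg, Real.exp_log hδ]
    have h2 : Real.exp (1 / 2) ≤ 2 := by
      rw [← Real.le_log_iff_exp_le (by norm_num)]
      linarith [Real.log_two_gt_d9]
    have : Real.exp (-(2 * l) + 1 / 2) = δ * δ * Real.exp (1 / 2) := by
      rw [Real.exp_add, show -(2 * l) = -l + -l by ring, Real.exp_add, hexp]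
    rw [this]
    nlinarith [Real.exp_pos (1 / 2 : ℝ)]

/-- Gaussian mechanism with `ε = 0`, by a comparison of total variation and `χ²` distance. -/
theorem gaussianVector_shift_le_add {k : ℕ} {σ δ : ℝ} (hσ : 0 < σ)
    (hδ : 0 < δ) (hδ2 : δ ≤ 1 / 2) (v : Fin k → ℝ)
    (hv : v ⬝ᵥ v / σ ^ 2 ≤ δ ^ 2 / (4 * Real.log (1 / δ))) {S : Set (Fin k → ℝ)}
    (hS : MeasurableSet S) :
    (gaussianVector k σ).map (fun z => v + z) S ≤
      ENNReal.ofReal 1 * gaussianVector k σ S + ENNReal.ofReal δ := by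
  have hl : 1 / 2 ≤ Real.log (1 / δ) := by
    have : Real.log 2 ≤ Real.log (1 / δ) :=
      Real.log_le_log (by norm_num) (by rw [le_div_iff₀ hδ]; linarith)
    linarith [Real.log_two_gt_d9]
  have hv2 : v ⬝ᵥ v / σ ^ 2 ≤ δ ^ 2 / 2 := hv.trans (by gcongr; linarith)
  have i1 := integrable_shiftDensity_rpow σ v 1
  have i2 := integrable_shiftDensity_rpow σ v 2
  have m1 := integral_shiftDensity_rpow hσ v 1
  have m2 := integral_shiftDensity_rpow hσ v 2
  simp only [Real.rpow_one, Real.rpow_two] at i1 i2 m1 m2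
  -- By AM-GM, `f - 1 ≤ (f - 1)²/(2δ) + δ/2`. The integral of `(f - 1)²` is `e^u - 1` with `u =
  -- ‖v‖²/σ² ≤ δ²/2`, hence at most `δ²`, and the two terms contribute `δ/2` each.
  have hfun : (fun z => (shiftDensity σ v z - 1) ^ 2 / (2 * δ) + δ / 2) = fun z =>
      (2 * δ)⁻¹ * shiftDensity σ v z ^ 2 - δ⁻¹ * shiftDensity σ v z +
        ((2 * δ)⁻¹ + δ / 2) := by
    funext z; field_simp; ring
  have j : Integrable (fun z => (2 * δ)⁻¹ * shiftDensity σ v z ^ 2 - δ⁻¹ * shiftDensity σ v z)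
      (gaussianVector k σ) := (i2.const_mul (2 * δ)⁻¹).sub (i1.const_mul δ⁻¹)
  have hint := j.add (integrable_const ((2 * δ)⁻¹ + δ / 2))
  refine gaussianVector_shift_le hσ zero_le_one v
    (fun z => (shiftDensity σ v z - 1) ^ 2 / (2 * δ) + δ / 2)
    (fun z => by positivity) (by rw [hfun]; exact hint) (fun z => ?_) ?_ hS
  · have : (shiftDensity σ v z - 1) ^ 2 / (2 * δ) + δ / 2 - (shiftDensity σ v z - 1) =
        (shiftDensity σ v z - 1 - δ) ^ 2 / (2 * δ) := by field_simp; ring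
    have h2 : 0 ≤ (shiftDensity σ v z - 1 - δ) ^ 2 / (2 * δ) := by positivity
    linarith
  · rw [hfun, integral_add j (integrable_const _),
      integral_sub (i2.const_mul _) (i1.const_mul _), integral_const_mul, integral_const_mul,
      m1, m2]
    simp only [integral_const, probReal_univ, one_smul]
    set u := v ⬝ᵥ v / σ ^ 2
    have hu0 : 0 ≤ u := div_nonneg (dotProduct_self_real_nonneg v) (sq_nonneg σ)
    have hu1 : u ≤ 1 / 8 := by nlinarith
    have he : Real.exp u ≤ 1 + 2 * u := by
      have := Real.exp_bound_div_one_sub_of_interval hu0 (by linarith : u < 1)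
      refine this.trans ?_
      rw [div_le_iff₀ (by linarith)]
      nlinarith
    have he' : Real.exp u ≤ 1 + δ ^ 2 := by linarith
    have e1 : (2 * (2 - 1) * u / 2 : ℝ) = u := by ring
    rw [e1]
    norm_num
    have : δ⁻¹ * 2⁻¹ * Real.exp u ≤ δ⁻¹ * 2⁻¹ * (1 + δ ^ 2) := by gcongr
    have e2 : δ⁻¹ * 2⁻¹ * (1 + δ ^ 2) = δ⁻¹ * 2⁻¹ + δ / 2 := by field_simp
    have e3 : δ⁻¹ * 2⁻¹ + δ⁻¹ * 2⁻¹ = δ⁻¹ := by ring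
    linarith

/-! ### Absolute moments of Gaussian linear forms. -/

theorem exp_neg_mul_two_le_one {p : ℝ} (hp : 2 ≤ p) : Real.exp (-(p / 2)) * 2 ≤ 1 := by
  have : Real.exp (-(p / 2)) ≤ Real.exp (-1) := Real.exp_le_exp.2 (by linarith)
  have h2 : Real.exp (-1) * Real.exp 1 = 1 := by rw [← Real.exp_add]; simp
  nlinarith [Real.add_one_le_exp (1 : ℝ), Real.exp_pos (-1 : ℝ)]

/-- The absolute moments of a Gaussian: `E |⟨w, z⟩|^p ≤ p^(p/2) (σ ‖w‖)^p`. -/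
theorem lintegral_abs_dotProduct_rpow_le {k : ℕ} {σ p : ℝ} (hσ : 0 < σ) (hp : 2 ≤ p)
    (w : Fin k → ℝ) :
    ∫⁻ z, ENNReal.ofReal (|w ⬝ᵥ z| ^ p) ∂(gaussianVector k σ) ≤
      ENNReal.ofReal ((Real.sqrt p * σ) ^ p * (w ⬝ᵥ w) ^ (p / 2)) := by
  have hp0 : 0 < p := by linarith
  have hw0 : 0 ≤ w ⬝ᵥ w := dotProduct_self_real_nonneg w
  rcases hw0.eq_or_lt with hw | hw
  · have : w = 0 := dotProduct_self_eq_zero.1 hw.symm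
    subst this
    simp [Real.zero_rpow hp0.ne']
  set s := σ * Real.sqrt (w ⬝ᵥ w) with hs
  have hs0 : 0 < s := by positivity
  -- `y ≤ e^(y-1)` at `y = |u| t / p` bounds `|u|^p` by `(p/t)^p e^(-p) e^(t|u|)`. This `t` makes
  -- `p/t = √p s` and each exponential moment `e^(p/2)`, leaving a factor `2 e^(-p/2) ≤ 1`.
  set t := Real.sqrt p / s with ht
  have hsp : 0 < Real.sqrt p := Real.sqrt_pos.2 hp0
  have ht0 : 0 < t := by positivity
  have ht2 : t ^ 2 * s ^ 2 = p := by
    rw [ht, div_pow, div_mul_cancel₀ _ (by positivity), Real.sq_sqrt hp0.le]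
  have hs2 : s ^ 2 = σ ^ 2 * (w ⬝ᵥ w) := by rw [hs, mul_pow, Real.sq_sqrt hw0]
  have hpt (z : Fin k → ℝ) : |w ⬝ᵥ z| ^ p ≤
      (p / t) ^ p * Real.exp (-p) * (Real.exp ((t • w) ⬝ᵥ z) + Real.exp (((-t) • w) ⬝ᵥ z)) := by
    rw [smul_dotProduct, smul_dotProduct, smul_eq_mul, smul_eq_mul]
    generalize w ⬝ᵥ z = u
    have h1 : |u| * t / p ≤ Real.exp (|u| * t / p - 1) := by
      linarith [Real.add_one_le_exp (|u| * t / p - 1)]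
    have h2 := Real.rpow_le_rpow (by positivity) h1 hp0.le
    rw [← Real.exp_mul] at h2
    have h3 : |u| = (p / t) * (|u| * t / p) := by field_simp
    have h4 : Real.exp ((|u| * t / p - 1) * p) = Real.exp (-p) * Real.exp (t * |u|) := by
      rw [← Real.exp_add]; congr 1; field_simp; ring
    have h5 : Real.exp (t * |u|) ≤ Real.exp (t * u) + Real.exp (-t * u) := by
      rcases abs_choice u with h | h <;> rw [h]
      · linarith [Real.exp_pos (-t * u)]
      · rw [mul_neg, ← neg_mul]
        linarith [Real.exp_pos (t * u)]
    calc |u| ^ p = (p / t) ^ p * (|u| * t / p) ^ p := by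
          rw [← Real.mul_rpow (by positivity) (by positivity), ← h3]
      _ ≤ (p / t) ^ p * (Real.exp (-p) * Real.exp (t * |u|)) := by
          rw [← h4]; gcongr
      _ ≤ _ := by rw [mul_assoc]; gcongr
  have i1 := integrable_exp_dotProduct_gaussianVector σ (t • w)
  have i2 := integrable_exp_dotProduct_gaussianVector σ ((-t) • w)
  calc ∫⁻ z, ENNReal.ofReal (|w ⬝ᵥ z| ^ p) ∂(gaussianVector k σ)
      ≤ ∫⁻ z, ENNReal.ofReal ((p / t) ^ p * Real.exp (-p) *
          (Real.exp ((t • w) ⬝ᵥ z) + Real.exp (((-t) • w) ⬝ᵥ z))) ∂(gaussianVector k σ) :=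
        lintegral_mono fun z => ENNReal.ofReal_le_ofReal (hpt z)
    _ = ENNReal.ofReal ((p / t) ^ p * Real.exp (-p) * (Real.exp (p / 2) + Real.exp (p / 2))) := by
        have i3 : Integrable (fun z => (p / t) ^ p * Real.exp (-p) *
            (Real.exp ((t • w) ⬝ᵥ z) + Real.exp (((-t) • w) ⬝ᵥ z))) (gaussianVector k σ) :=
          (i1.add i2).const_mul _
        rw [← ofReal_integral_eq_lintegral_ofReal i3 (ae_of_all _ fun z => by
          simp only [Pi.zero_apply]; positivity), integral_const_mul, integral_add i1 i2,
          integral_exp_dotProduct_gaussianVector,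
          integral_exp_dotProduct_gaussianVector]
        have e1 : σ ^ 2 * ((t • w) ⬝ᵥ (t • w)) / 2 = p / 2 := by
          rw [smul_dotProduct, dotProduct_smul, smul_eq_mul, smul_eq_mul, ← ht2, hs2]; ring
        have e2 : σ ^ 2 * (((-t) • w) ⬝ᵥ ((-t) • w)) / 2 = p / 2 := by
          rw [smul_dotProduct, dotProduct_smul, smul_eq_mul, smul_eq_mul, ← ht2, hs2]; ring
        rw [e1, e2]
    _ ≤ _ := by
        refine ENNReal.ofReal_le_ofReal ?_
        have e1 : p / t = Real.sqrt p * σ * Real.sqrt (w ⬝ᵥ w) := by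
          rw [ht, hs]
          field_simp
          rw [Real.sq_sqrt hp0.le]
        have e2 : Real.sqrt (w ⬝ᵥ w) ^ p = (w ⬝ᵥ w) ^ (p / 2) := by
          rw [Real.sqrt_eq_rpow, ← Real.rpow_mul hw0]; congr 1; ring
        have e3 : Real.exp (-p) * (Real.exp (p / 2) + Real.exp (p / 2)) =
            Real.exp (-(p / 2)) * 2 := by
          rw [← two_mul, ← mul_assoc, mul_right_comm, ← Real.exp_add]; congr 2; ring
        rw [e1, Real.mul_rpow (by positivity) (by positivity), e2, mul_assoc _ (Real.exp (-p)), e3]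
        exact mul_le_of_le_one_right (by positivity) (exp_neg_mul_two_le_one hp)

/-! ### Factorizations and the norms entering `γ_(p)`. -/

open scoped MatrixOrder Matrix.Norms.L2Operator in
theorem Matrix.PosSemidef.exists_eq_transpose_mul_self {m : ℕ}
    {U : Matrix (Fin m) (Fin m) ℝ} (hU : U.PosSemidef) :
    ∃ B : Matrix (Fin m) (Fin m) ℝ, U = Bᵀ * B := by
  obtain ⟨B, hB⟩ := CStarAlgebra.nonneg_iff_eq_star_mul_self.1 hU.nonneg
  exact ⟨B, by simpa [star_eq_conjTranspose, conjTranspose_eq_transpose_of_trivial] using hB⟩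

/-- Cauchy–Schwarz with weights `|x j|` of total mass at most one: on the `ℓ¹` ball, `‖R x‖₂` is
controlled by the longest column. -/
theorem sqrt_sum_sq_mulVec_le {k n : ℕ} {R : Matrix (Fin k) (Fin n) ℝ} {ρ : ℝ} (hρ : 0 ≤ ρ)
    (h : ∀ j, ∑ i, R i j ^ 2 ≤ ρ ^ 2) {x : Fin n → ℝ} (hx : ∑ j, |x j| ≤ 1) :
    Real.sqrt (∑ i, (R *ᵥ x) i ^ 2) ≤ ρ := by
  refine Real.sqrt_le_iff.2 ⟨hρ, ?_⟩
  calc ∑ i, (R *ᵥ x) i ^ 2 ≤ ∑ i, ∑ j, |x j| * R i j ^ 2 := by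
        refine Finset.sum_le_sum fun i _ => ?_
        have := Finset.sum_sq_le_sum_mul_sum_of_sq_le_mul Finset.univ
          (r := fun j => R i j * x j) (f := fun j => |x j|) (g := fun j => |x j| * R i j ^ 2)
          (fun j _ => abs_nonneg _) (fun j _ => by positivity)
          (fun j _ => by rw [← mul_assoc, ← sq, sq_abs, mul_pow, mul_comm])
        have h0 : 0 ≤ ∑ j, |x j| * R i j ^ 2 := Finset.sum_nonneg fun j _ => by positivity
        exact this.trans (mul_le_of_le_one_left h0 hx)
    _ = ∑ j, |x j| * ∑ i, R i j ^ 2 := by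
        rw [Finset.sum_comm]
        simp_rw [Finset.mul_sum]
    _ ≤ ∑ j, |x j| * ρ ^ 2 := by gcongr with j _; exact h j
    _ ≤ ρ ^ 2 := by
        rw [← Finset.sum_mul]
        exact mul_le_of_le_one_left (sq_nonneg ρ) hx

theorem oneTwoNorm_le {k n : ℕ} {R : Matrix (Fin k) (Fin n) ℝ} {ρ : ℝ} (hρ : 0 ≤ ρ)
    (h : ∀ j, ∑ i, R i j ^ 2 ≤ ρ ^ 2) : oneTwoNorm R ≤ ρ :=
  Real.sSup_le (by rintro r ⟨x, hx, rfl⟩; exact sqrt_sum_sq_mulVec_le hρ h hx) hρ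

theorem oneTwoNorm_nonneg {k n : ℕ} (R : Matrix (Fin k) (Fin n) ℝ) : 0 ≤ oneTwoNorm R :=
  Real.sSup_nonneg (by rintro r ⟨x, -, rfl⟩; exact Real.sqrt_nonneg _)

theorem sqrt_sum_sq_mulVec_le_oneTwoNorm {k n : ℕ} (R : Matrix (Fin k) (Fin n) ℝ) {x : Fin n → ℝ}
    (hx : ∑ j, |x j| ≤ 1) : Real.sqrt (∑ i, (R *ᵥ x) i ^ 2) ≤ oneTwoNorm R := by
  refine le_csSup ⟨Real.sqrt (∑ j, ∑ i, R i j ^ 2), ?_⟩ ⟨x, hx, rfl⟩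
  rintro r ⟨y, hy, rfl⟩
  refine sqrt_sum_sq_mulVec_le (Real.sqrt_nonneg _) (fun j => ?_) hy
  rw [Real.sq_sqrt (Finset.sum_nonneg fun _ _ => Finset.sum_nonneg fun _ _ => sq_nonneg _)]
  exact Finset.single_le_sum (f := fun j => ∑ i, R i j ^ 2)
    (fun _ _ => Finset.sum_nonneg fun _ _ => sq_nonneg _) (Finset.mem_univ j)

theorem gammaNorm_le {m k n : ℕ} (p : ℝ) (L : Matrix (Fin m) (Fin k) ℝ)
    (R : Matrix (Fin k) (Fin n) ℝ) :
    gammaNorm p (L * R) ≤ Real.sqrt (pTrace (p / 2) (L * Lᵀ)) * oneTwoNorm R := by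
  refine csInf_le ⟨0, ?_⟩ ⟨k, L, R, rfl, rfl⟩
  rintro r ⟨k, L, R, -, rfl⟩
  exact mul_nonneg (Real.sqrt_nonneg _) (oneTwoNorm_nonneg R)

theorem gammaNorm_nonneg {m n : ℕ} (p : ℝ) (A : Matrix (Fin m) (Fin n) ℝ) : 0 ≤ gammaNorm p A := by
  refine Real.sInf_nonneg ?_
  rintro r ⟨k, L, R, -, rfl⟩
  exact mul_nonneg (Real.sqrt_nonneg _) (oneTwoNorm_nonneg R)

theorem exists_factorization_lt {m n : ℕ} {p b : ℝ} {A : Matrix (Fin m) (Fin n) ℝ}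
    (h : gammaNorm p A < b) :
    ∃ (k : ℕ) (L : Matrix (Fin m) (Fin k) ℝ) (R : Matrix (Fin k) (Fin n) ℝ),
      L * R = A ∧ Real.sqrt (pTrace (p / 2) (L * Lᵀ)) * oneTwoNorm R < b := by
  rw [gammaNorm] at h
  obtain ⟨r, ⟨k, L, R, hA, rfl⟩, hr⟩ :=
    exists_lt_of_csInf_lt (by exact ⟨_, n, A, 1, A.mul_one, rfl⟩) h
  exact ⟨k, L, R, hA, hr⟩

theorem le_pTrace {d : ℕ} {q : ℝ} (hq : 0 < q) {U : Matrix (Fin d) (Fin d) ℝ}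
    (hU : ∀ i, 0 ≤ U i i) (i : Fin d) : U i i ≤ pTrace q U := by
  have h := Finset.single_le_sum (f := fun i => U i i ^ q)
    (fun i _ => Real.rpow_nonneg (hU i) q) (Finset.mem_univ i)
  calc U i i = (U i i ^ q) ^ (1 / q) := by
        rw [← Real.rpow_mul (hU i), mul_one_div_cancel hq.ne', Real.rpow_one]
    _ ≤ _ := Real.rpow_le_rpow (Real.rpow_nonneg (hU i) q) h (by positivity)

theorem mul_transpose_diag_nonneg {m k : ℕ} (L : Matrix (Fin m) (Fin k) ℝ) (i : Fin m) :
    0 ≤ (L * Lᵀ) i i :=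
  dotProduct_self_real_nonneg (L i)

theorem sum_sq_col_le {k n : ℕ} (R : Matrix (Fin k) (Fin n) ℝ) (j : Fin n) :
    ∑ i, R i j ^ 2 ≤ oneTwoNorm R ^ 2 := by
  have := sqrt_sum_sq_mulVec_le_oneTwoNorm R (x := Pi.single j 1) (by
    rw [Finset.sum_eq_single j] <;> simp +contextual)
  simp only [mulVec_single_one, col_apply] at this
  exact (Real.sqrt_le_left (oneTwoNorm_nonneg R)).1 this

/-- Cauchy–Schwarz between a row of `L` and a column of `R`. It serves to show that `γ_(p)(A) = 0`
forces `A = 0`. -/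
theorem abs_entry_le_gammaNorm {m n : ℕ} {p : ℝ} (hp : 0 < p) (A : Matrix (Fin m) (Fin n) ℝ)
    (i : Fin m) (j : Fin n) : |A i j| ≤ gammaNorm p A := by
  refine le_csInf ⟨_, n, A, 1, A.mul_one, rfl⟩ ?_
  rintro r ⟨k, L, R, rfl, rfl⟩
  refine abs_le_of_sq_le_sq ?_ (mul_nonneg (Real.sqrt_nonneg _) (oneTwoNorm_nonneg R))
  have h1 := le_pTrace (half_pos hp) (mul_transpose_diag_nonneg L) i
  rw [mul_pow, Real.sq_sqrt ((mul_transpose_diag_nonneg L i).trans h1)]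
  calc (L * R) i j ^ 2 ≤ (∑ l, L i l ^ 2) * ∑ l, R l j ^ 2 :=
        Finset.sum_mul_sq_le_sq_mul_sq Finset.univ (fun l => L i l) fun l => R l j
    _ ≤ _ := by
        refine mul_le_mul (le_trans (le_of_eq ?_) h1) (sum_sq_col_le R j)
          (Finset.sum_nonneg fun _ _ => sq_nonneg _) ((mul_transpose_diag_nonneg L i).trans h1)
        simp [Matrix.mul_apply, sq]

/-! ### From second moments to a factorization. -/

/-- Otherwise some functional `θ` vanishes on the range of `U` but not at `a`, so `θᵀ U θ = 0 < β
⟨θ, a⟩²`. This replaces inverting `U`, which may be singular. -/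
theorem exists_mulVec_eq_of_forall_sq_le {m : ℕ} {U : Matrix (Fin m) (Fin m) ℝ} {β : ℝ}
    (hβ : 0 < β) {a : Fin m → ℝ} (h : ∀ θ, β * (θ ⬝ᵥ a) ^ 2 ≤ θ ⬝ᵥ (U *ᵥ θ)) :
    ∃ θ, U *ᵥ θ = a := by
  by_contra hcon
  have hnot : a ∉ LinearMap.range U.mulVecLin := by
    rintro ⟨θ, hθ⟩
    exact hcon ⟨θ, hθ⟩
  obtain ⟨f, hfa, hf⟩ := Submodule.exists_le_ker_of_notMem hnot
  set θ : Fin m → ℝ := fun i => f (Pi.single i 1) with hθ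
  have hdot (w : Fin m → ℝ) : f w = θ ⬝ᵥ w := by
    conv_lhs => rw [pi_eq_sum_univ' w]
    simp only [map_sum, map_smul, smul_eq_mul, dotProduct, hθ]
    refine Finset.sum_congr rfl fun i _ => ?_
    rw [mul_comm]
  have h0 : θ ⬝ᵥ (U *ᵥ θ) = 0 := by
    rw [← hdot]
    exact hf ⟨θ, rfl⟩
  have := h θ
  rw [h0, ← hdot] at this
  have : 0 < β * f a ^ 2 := by positivity
  linarith

/-- If the positive semidefinite matrix `U` dominates `β a aᵀ` for every column `a` of `A`, then
`γ_(p)(A) ≤ √(tr_{p/2} U) / √β`. -/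
theorem gammaNorm_le_of_posSemidef {m n : ℕ} (p : ℝ) {A : Matrix (Fin m) (Fin n) ℝ}
    {U : Matrix (Fin m) (Fin m) ℝ} (hU : U.PosSemidef) {β : ℝ} (hβ : 0 < β)
    (h : ∀ j θ, β * (θ ⬝ᵥ A.col j) ^ 2 ≤ θ ⬝ᵥ (U *ᵥ θ)) :
    gammaNorm p A ≤ Real.sqrt (pTrace (p / 2) U) * (1 / Real.sqrt β) := by
  obtain ⟨B, hB⟩ := hU.exists_eq_transpose_mul_self
  have hB : U = Bᵀ * Bᵀᵀ := hB
  choose θ hθ using fun j => exists_mulVec_eq_of_forall_sq_le hβ (h j)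
  -- With `U θ_j = a_j`, the matrix with columns `B θ_j` satisfies `Bᵀ R = A`, and its `j`-th column
  -- has squared length `θ_jᵀ U θ_j = ⟨θ_j, a_j⟩`.
  set R : Matrix (Fin m) (Fin n) ℝ := Matrix.of fun i j => (B *ᵥ θ j) i with hR
  have hA : Bᵀ * R = A := by
    ext i j
    have := congrFun (hθ j) i
    rw [hB, transpose_transpose, ← mulVec_mulVec] at this
    exact this
  have hcol (j : Fin n) : ∑ i, R i j ^ 2 ≤ (1 / Real.sqrt β) ^ 2 := by
    have e1 : ∑ i, R i j ^ 2 = θ j ⬝ᵥ A.col j := by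
      rw [← hθ j, hB, transpose_transpose, ← mulVec_mulVec, dotProduct_mulVec, vecMul_transpose]
      simp [dotProduct, hR, sq]
    -- Domination tested at `θ_j` reads `β t² ≤ t` for `t = ⟨θ_j, a_j⟩ ≥ 0`, whence `t ≤ 1/β`.
    have h2 := h j (θ j)
    rw [hθ j] at h2
    rw [e1, div_pow, one_pow, Real.sq_sqrt hβ.le, le_div_iff₀ hβ]
    by_contra! hlt
    nlinarith [e1.symm.trans_ge (Finset.sum_nonneg fun i _ => sq_nonneg (R i j))]
  calc gammaNorm p A = gammaNorm p (Bᵀ * R) := by rw [hA]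
    _ ≤ Real.sqrt (pTrace (p / 2) (Bᵀ * Bᵀᵀ)) * oneTwoNorm R := gammaNorm_le p _ _
    _ ≤ _ := by
        rw [← hB]
        gcongr
        exact oneTwoNorm_le (by positivity) hcol

theorem rpow_abs_eq_sq_rpow (t p : ℝ) : |t| ^ p = (t ^ 2) ^ (p / 2) := by
  rw [← sq_abs, ← Real.rpow_two, ← Real.rpow_mul (abs_nonneg t)]
  congr 1
  ring

/-- If the second moments of `ν` in direction `θ` dominate `β ⟨θ, a⟩²` for every column `a` of `A`,
then the `p`-th moment of `ν` bounds `γ_(p)(A)`. -/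
theorem gammaNorm_le_of_secondMoment {m n : ℕ} {p : ℝ} (hp : 2 ≤ p)
    {A : Matrix (Fin m) (Fin n) ℝ} (ν : Measure (Fin m → ℝ)) [IsProbabilityMeasure ν]
    {E β : ℝ} (hE : 0 ≤ E) (hβ : 0 < β)
    (hν : ∫⁻ z, ENNReal.ofReal (∑ i, |z i| ^ p) ∂ν ≤ ENNReal.ofReal (E ^ p))
    (h : ∀ j (θ : Fin m → ℝ),
      ENNReal.ofReal (β * (θ ⬝ᵥ A.col j) ^ 2) ≤ ∫⁻ z, ENNReal.ofReal ((θ ⬝ᵥ z) ^ 2) ∂ν) :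
    gammaNorm p A ≤ E * (1 / Real.sqrt β) := by
  have hp0 : 0 < p := by linarith
  have hpos (z : Fin m → ℝ) : 0 ≤ ∑ i, |z i| ^ p :=
    Finset.sum_nonneg fun i _ => Real.rpow_nonneg (abs_nonneg _) _
  have hmeas (i : Fin m) : Measurable fun z : Fin m → ℝ => |z i| ^ p :=
    ((measurable_pi_apply i).abs).pow_const p
  have hsum : Integrable (fun z : Fin m → ℝ => ∑ i, |z i| ^ p) ν := by
    refine ⟨(Finset.measurable_sum _ fun i _ => hmeas i).aestronglyMeasurable, ?_⟩
    rw [hasFiniteIntegral_iff_ofReal (ae_of_all _ hpos)]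
    exact hν.trans_lt ENNReal.ofReal_lt_top
  have hint (i : Fin m) : Integrable (fun z : Fin m → ℝ => |z i| ^ p) ν := by
    refine hsum.mono' (hmeas i).aestronglyMeasurable (ae_of_all _ fun z => ?_)
    rw [Real.norm_of_nonneg (Real.rpow_nonneg (abs_nonneg _) _)]
    exact Finset.single_le_sum (f := fun i => |z i| ^ p)
      (fun i _ => Real.rpow_nonneg (abs_nonneg _) _) (Finset.mem_univ i)
  have hLp (i : Fin m) : MemLp (fun z : Fin m → ℝ => z i) 2 ν := by
    have : MemLp (fun z : Fin m → ℝ => z i) (ENNReal.ofReal p) ν := by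
      rw [← integrable_norm_rpow_iff (measurable_pi_apply i).aestronglyMeasurable
        (by simpa using hp0) ENNReal.ofReal_ne_top, ENNReal.toReal_ofReal hp0.le]
      exact hint i
    exact this.mono_exponent (by simpa using ENNReal.ofReal_le_ofReal hp)
  have hmul (i j : Fin m) : Integrable (fun z : Fin m → ℝ => z i * z j) ν :=
    (hLp i).integrable_mul (hLp j)
  set U : Matrix (Fin m) (Fin m) ℝ := Matrix.of fun i j => ∫ z, z i * z j ∂ν with hU
  have hexpand (θ z : Fin m → ℝ) : (θ ⬝ᵥ z) ^ 2 = ∑ i, ∑ j, θ i * θ j * (z i * z j) := by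
    rw [sq, dotProduct, Finset.sum_mul_sum]
    exact Finset.sum_congr rfl fun i _ => Finset.sum_congr rfl fun j _ => by ring
  have hsq (θ : Fin m → ℝ) : Integrable (fun z => (θ ⬝ᵥ z) ^ 2) ν := by
    simp_rw [hexpand]
    exact integrable_finsetSum _ fun i _ => integrable_finsetSum _ fun j _ =>
      (hmul i j).const_mul _
  have hquad (θ : Fin m → ℝ) : θ ⬝ᵥ (U *ᵥ θ) = ∫ z, (θ ⬝ᵥ z) ^ 2 ∂ν := by
    simp_rw [hexpand]
    rw [integral_finsetSum _ fun i _ => integrable_finsetSum _ fun j _ => (hmul i j).const_mul _]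
    simp_rw [integral_finsetSum Finset.univ fun j _ => (hmul _ j).const_mul _, integral_const_mul]
    simp only [dotProduct, mulVec, Finset.mul_sum, hU, of_apply]
    exact Finset.sum_congr rfl fun i _ => Finset.sum_congr rfl fun j _ => by ring
  have hpsd : U.PosSemidef := by
    refine .of_dotProduct_mulVec_nonneg ?_ fun θ => ?_
    · ext i j
      simp [hU, mul_comm]
    · rw [star_trivial, hquad]
      exact integral_nonneg fun z => sq_nonneg _
  have hdom (j : Fin n) (θ : Fin m → ℝ) : β * (θ ⬝ᵥ A.col j) ^ 2 ≤ θ ⬝ᵥ (U *ᵥ θ) := by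
    have := h j θ
    rw [← ofReal_integral_eq_lintegral_ofReal (hsq θ) (ae_of_all _ fun z => sq_nonneg _)] at this
    rw [hquad]
    exact (ENNReal.ofReal_le_ofReal_iff (integral_nonneg fun z => sq_nonneg _)).1 this
  have hdiag (i : Fin m) : 0 ≤ U i i := integral_nonneg fun z => mul_self_nonneg (z i)
  -- Jensen for the convex power `p/2 ≥ 1`; this is where `p ≥ 2` is essential, besides making
  -- second moments finite.
  have hjensen (i : Fin m) : U i i ^ (p / 2) ≤ ∫ z, |z i| ^ p ∂ν := by
    have hc := convexOn_rpow (p := p / 2) (by linarith)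
    have := hc.map_integral_le (μ := ν) (f := fun z : Fin m → ℝ => z i * z i)
      (Real.continuous_rpow_const (by positivity)).continuousOn isClosed_Ici
      (ae_of_all _ fun z => mul_self_nonneg (z i)) (hmul i i)
      ((hint i).congr (ae_of_all _ fun z => by
        simp only [Function.comp_apply]
        rw [rpow_abs_eq_sq_rpow, sq]))
    refine this.trans (le_of_eq (integral_congr_ae (ae_of_all _ fun z => ?_)))
    simp only
    rw [rpow_abs_eq_sq_rpow, sq]
  have htr : Real.sqrt (pTrace (p / 2) U) ≤ E := by
    refine Real.sqrt_le_iff.2 ⟨hE, ?_⟩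
    have h1 : ∑ i, U i i ^ (p / 2) ≤ E ^ p := by
      refine (Finset.sum_le_sum fun i _ => hjensen i).trans ?_
      rw [← integral_finsetSum _ fun i _ => hint i]
      rw [← ofReal_integral_eq_lintegral_ofReal hsum (ae_of_all _ hpos)] at hν
      exact (ENNReal.ofReal_le_ofReal_iff (by positivity)).1 hν
    calc pTrace (p / 2) U ≤ (E ^ p) ^ (1 / (p / 2)) :=
          Real.rpow_le_rpow (Finset.sum_nonneg fun i _ => Real.rpow_nonneg (hdiag i) _) h1
            (by positivity)
      _ = E ^ 2 := by
          rw [← Real.rpow_mul hE, ← Real.rpow_two]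
          congr 1
          field_simp
  refine (gammaNorm_le_of_posSemidef p hpsd hβ hdom).trans ?_
  gcongr

/-! ### Group privacy and the two-point test. -/

/-- Chain the inequality along `x, x + d, …, x + k d`: the factors `e^ε` multiply and the `δ`'s
accumulate as a geometric sum. -/
theorem IsDP.group {n m : ℕ} {ε δ : ℝ} (hδ : 0 ≤ δ) {M : Mechanism n m} (hM : IsDP ε δ M)
    {d : Fin n → ℝ} (hd : ∑ j, |d j| ≤ 1) {S : Set (Fin m → ℝ)} (hS : MeasurableSet S)
    (x : Fin n → ℝ) (k : ℕ) :
    (M x : Measure (Fin m → ℝ)) S ≤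
      ENNReal.ofReal (Real.exp (k * ε)) * (M (x + (k : ℝ) • d) : Measure (Fin m → ℝ)) S +
        ENNReal.ofReal (δ * ∑ i ∈ Finset.range k, Real.exp (i * ε)) := by
  induction k with
  | zero => simp
  | succ k ih =>
    have hstep := hM (x + (k : ℝ) • d) (x + ((k + 1 : ℕ) : ℝ) • d) (by
      simp only [Neighboring, Pi.add_apply, Pi.smul_apply, smul_eq_mul, Nat.cast_add, Nat.cast_one]
      refine le_trans (le_of_eq (Finset.sum_congr rfl fun j _ => ?_)) hd
      rw [← abs_neg]
      congr 1
      ring) S hS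
    refine (ih.trans (add_le_add_left (mul_le_mul_right hstep _) _)).trans (le_of_eq ?_)
    rw [mul_add, ← mul_assoc, ← ENNReal.ofReal_mul (Real.exp_pos _).le, ← Real.exp_add,
      ← ENNReal.ofReal_mul (Real.exp_pos _).le, add_assoc, ← ENNReal.ofReal_add (by positivity)
      (by positivity), Finset.sum_range_succ]
    congr 3
    · push_cast; ring_nf
    · ring

/-- Testing `P` against `Q`: if `|u| < |D|/2` then `|u - D| ≥ |D|/2`, so by Markov the two moments
bound `(D²/4)(P S + Q Sᶜ)`. Indistinguishability gives `1 ≤ P S + a Q Sᶜ + δ`. -/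
theorem secondMoment_add_ge {Ω : Type*} [MeasurableSpace Ω] (P Q : Measure Ω)
    [IsProbabilityMeasure P] {a δ D : ℝ} (ha : 1 ≤ a) (hδ : 0 ≤ δ) {u : Ω → ℝ}
    (hu : Measurable u)
    (hPQ : ∀ S, MeasurableSet S → P S ≤ ENNReal.ofReal a * Q S + ENNReal.ofReal δ) :
    ENNReal.ofReal ((1 - δ) / (4 * a) * D ^ 2) ≤
      ∫⁻ y, ENNReal.ofReal (u y ^ 2) ∂P + ∫⁻ y, ENNReal.ofReal ((u y - D) ^ 2) ∂Q := by
  set S : Set Ω := {y | ENNReal.ofReal (D ^ 2 / 4) ≤ ENNReal.ofReal (u y ^ 2)} with hSdef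
  have hm1 : Measurable fun y => ENNReal.ofReal (u y ^ 2) := by fun_prop
  have hm2 : Measurable fun y => ENNReal.ofReal ((u y - D) ^ 2) := by fun_prop
  have hS : MeasurableSet S := measurableSet_le measurable_const hm1
  have h1 : ENNReal.ofReal (D ^ 2 / 4) * P S ≤ ∫⁻ y, ENNReal.ofReal (u y ^ 2) ∂P :=
    mul_meas_ge_le_lintegral hm1 _
  have h2 : ENNReal.ofReal (D ^ 2 / 4) * Q Sᶜ ≤ ∫⁻ y, ENNReal.ofReal ((u y - D) ^ 2) ∂Q := by
    refine le_trans ?_ (mul_meas_ge_le_lintegral hm2 (ENNReal.ofReal (D ^ 2 / 4)))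
    gcongr
    intro y hy
    simp only [hSdef, Set.mem_compl_iff, Set.mem_ofPred_eq, not_le] at hy ⊢
    have hy' := lt_of_not_ge fun hle => hy.not_ge (ENNReal.ofReal_le_ofReal hle)
    refine ENNReal.ofReal_le_ofReal ?_
    nlinarith [sq_nonneg (2 * u y - D)]
  have h3 : (1 : ℝ≥0∞) ≤ ENNReal.ofReal a * (P S + Q Sᶜ) + ENNReal.ofReal δ := by
    rw [← prob_add_prob_compl (μ := P) hS, mul_add, add_assoc]
    refine add_le_add (le_mul_of_one_le_left zero_le ?_) (hPQ _ hS.compl)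
    simpa using ENNReal.ofReal_le_ofReal ha
  have h4 : ENNReal.ofReal (1 - δ) ≤ ENNReal.ofReal a * (P S + Q Sᶜ) := by
    rw [ENNReal.ofReal_sub _ hδ, ENNReal.ofReal_one]
    exact tsub_le_iff_right.2 h3
  have ha0 : 0 < a := by linarith
  calc ENNReal.ofReal ((1 - δ) / (4 * a) * D ^ 2)
      = ENNReal.ofReal (D ^ 2 / 4) * (ENNReal.ofReal a⁻¹ * ENNReal.ofReal (1 - δ)) := by
        rw [← ENNReal.ofReal_mul (by positivity), ← ENNReal.ofReal_mul (by positivity)]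
        congr 1
        field_simp
    _ ≤ ENNReal.ofReal (D ^ 2 / 4) * (P S + Q Sᶜ) := by
        gcongr
        calc _ ≤ ENNReal.ofReal a⁻¹ * (ENNReal.ofReal a * (P S + Q Sᶜ)) := by gcongr
          _ = _ := by
            rw [← mul_assoc, ← ENNReal.ofReal_mul (by positivity), inv_mul_cancel₀ ha0.ne',
              ENNReal.ofReal_one, one_mul]
    _ ≤ _ := by
        rw [mul_add]
        exact add_le_add h1 h2

/-! ### Averaging the error over a cube. -/

/-- The vertex of the cube `{0, r}ⁿ` with coordinates `r` where `s` is true. -/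
def cubeVertex {n : ℕ} (r : ℝ) (s : Fin n → Bool) : Fin n → ℝ := fun j => if s j then r else 0

/-- Flipping the `j`-th coordinate of a Boolean vector. -/
def flipCoord {n : ℕ} (j : Fin n) : Equiv.Perm (Fin n → Bool) :=
  Function.Involutive.toPerm (fun s => Function.update s j (!s j)) fun s => by simp

theorem flipCoord_apply {n : ℕ} (j : Fin n) (s : Fin n → Bool) :
    flipCoord j s = Function.update s j (!s j) := rfl

theorem cubeVertex_flipCoord {n : ℕ} (r : ℝ) (s : Fin n → Bool) (j : Fin n) :
    cubeVertex r (flipCoord j s) = cubeVertex r s + r • Pi.single j (if s j then -1 else 1) := by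
  ext i
  rcases eq_or_ne i j with rfl | h
  · cases hs : s i <;> simp [cubeVertex, flipCoord_apply, hs]
  · simp [cubeVertex, flipCoord_apply, h]

/-- The law of the error `M(x) - A x`, averaged over the vertices `x` of the cube `{0, r}ⁿ`. -/
noncomputable def cubeError {n m : ℕ} (M : Mechanism n m) (A : Matrix (Fin m) (Fin n) ℝ) (r : ℝ) :
    Measure (Fin m → ℝ) :=
  ((Fintype.card (Fin n → Bool) : ℝ≥0∞)⁻¹) • ∑ s : Fin n → Bool,
    (M (cubeVertex r s) : Measure (Fin m → ℝ)).map fun y => y - A *ᵥ cubeVertex r s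

theorem lintegral_cubeError {n m : ℕ} (M : Mechanism n m) (A : Matrix (Fin m) (Fin n) ℝ) (r : ℝ)
    {f : (Fin m → ℝ) → ℝ≥0∞} (hf : Measurable f) :
    ∫⁻ z, f z ∂(cubeError M A r) = (Fintype.card (Fin n → Bool) : ℝ≥0∞)⁻¹ *
      ∑ s : Fin n → Bool, ∫⁻ y, f (y - A *ᵥ cubeVertex r s)
        ∂(M (cubeVertex r s) : Measure (Fin m → ℝ)) := by
  rw [cubeError, lintegral_smul_measure, lintegral_finsetSum_measure, smul_eq_mul]
  congr 1
  exact Finset.sum_congr rfl fun s _ => lintegral_map hf (by fun_prop)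

theorem inv_card_mul_sum_le {ι : Type*} [Fintype ι] [Nonempty ι] {f : ι → ℝ≥0∞} {b : ℝ≥0∞}
    (h : ∀ s, f s ≤ b) : (Fintype.card ι : ℝ≥0∞)⁻¹ * ∑ s, f s ≤ b := by
  rw [mul_comm, ← div_eq_mul_inv]
  refine ENNReal.div_le_of_le_mul ?_
  simpa [mul_comm] using Finset.sum_le_sum fun s (_ : s ∈ Finset.univ) => h s

instance {n m : ℕ} (M : Mechanism n m) (A : Matrix (Fin m) (Fin n) ℝ) (r : ℝ) :
    IsProbabilityMeasure (cubeError M A r) := by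
  constructor
  rw [← lintegral_one, lintegral_cubeError _ _ _ measurable_const]
  simp only [lintegral_one, measure_univ, Finset.sum_const, Finset.card_univ, nsmul_eq_mul, mul_one]
  exact ENNReal.inv_mul_cancel (by simp) (by simp)

/-- Each vertex is paired with its neighbor along coordinate `j`, where the two-point bound applies
with `D = ± k ⟨θ, a_j⟩`. The sign depends on the vertex but disappears in `D²`; averaging the pair
turns the constant `4` into `8`. -/
theorem secondMoment_cubeError_ge {n m : ℕ} {ε δ : ℝ} (hε : 0 ≤ ε) (hδ : 0 ≤ δ)
    {M : Mechanism n m} (hM : IsDP ε δ M) (A : Matrix (Fin m) (Fin n) ℝ) (k : ℕ) (j : Fin n)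
    (θ : Fin m → ℝ) :
    ENNReal.ofReal ((1 - δ * ∑ i ∈ Finset.range k, Real.exp (i * ε)) / (8 * Real.exp (k * ε)) *
        k ^ 2 * (θ ⬝ᵥ A.col j) ^ 2) ≤
      ∫⁻ z, ENNReal.ofReal ((θ ⬝ᵥ z) ^ 2) ∂(cubeError M A k) := by
  have hdot : Measurable fun z : Fin m → ℝ => θ ⬝ᵥ z := by
    unfold dotProduct
    fun_prop
  rw [lintegral_cubeError _ _ _ (by fun_prop)]
  set F : (Fin n → Bool) → ℝ≥0∞ := fun s => ∫⁻ y,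
    ENNReal.ofReal ((θ ⬝ᵥ (y - A *ᵥ cubeVertex (k : ℝ) s)) ^ 2)
      ∂(M (cubeVertex (k : ℝ) s) : Measure (Fin m → ℝ)) with hF
  set B : ℝ := (1 - δ * ∑ i ∈ Finset.range k, Real.exp (i * ε)) / (8 * Real.exp (k * ε)) *
    k ^ 2 * (θ ⬝ᵥ A.col j) ^ 2 with hB
  have hpair (s : Fin n → Bool) : 2 * ENNReal.ofReal B ≤ F s + F (flipCoord j s) := by
    have hd : ∑ i, |(Pi.single j (if s j then -1 else 1) : Fin n → ℝ) i| ≤ 1 := by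
      rw [Finset.sum_eq_single j]
      · split_ifs <;> simp
      · intro i _ hi
        simp [hi]
      · simp
    have hu : Measurable fun y : Fin m → ℝ => θ ⬝ᵥ (y - A *ᵥ cubeVertex (k : ℝ) s) :=
      hdot.comp (measurable_id.sub_const _)
    have := secondMoment_add_ge
      (M (cubeVertex (k : ℝ) s) : Measure (Fin m → ℝ))
      (M (cubeVertex (k : ℝ) (flipCoord j s)) : Measure (Fin m → ℝ))
      (a := Real.exp (k * ε)) (δ := δ * ∑ i ∈ Finset.range k, Real.exp (i * ε))
      (D := k * ((if s j then -1 else 1) * (θ ⬝ᵥ A.col j)))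
      (Real.one_le_exp (by positivity)) (by positivity) hu (fun S hS => by
        rw [cubeVertex_flipCoord]
        exact hM.group hδ hd hS _ k)
    refine le_trans (le_of_eq ?_) (this.trans (le_of_eq ?_))
    · rw [show (2 : ℝ≥0∞) = ENNReal.ofReal 2 by simp, ← ENNReal.ofReal_mul (by norm_num), hB]
      congr 1
      have : ((if s j then -1 else 1 : ℝ)) ^ 2 = 1 := by split_ifs <;> norm_num
      rw [mul_pow, mul_pow, this]
      generalize ∑ i ∈ Finset.range k, Real.exp (i * ε) = t
      field_simp
      ring
    · simp only [hF]
      congr 1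
      refine lintegral_congr fun y => ?_
      congr 2
      rw [cubeVertex_flipCoord, mulVec_add, mulVec_smul, mulVec_single, dotProduct_sub,
        dotProduct_sub, dotProduct_add, dotProduct_smul, dotProduct_smul, smul_eq_mul,
        MulOpposite.smul_eq_mul_unop, MulOpposite.unop_op]
      ring
  have hsum : (Fintype.card (Fin n → Bool) : ℝ≥0∞) * (2 * ENNReal.ofReal B) ≤ 2 * ∑ s, F s := by
    calc (Fintype.card (Fin n → Bool) : ℝ≥0∞) * (2 * ENNReal.ofReal B)
        = ∑ _s : Fin n → Bool, 2 * ENNReal.ofReal B := by simp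
      _ ≤ ∑ s, (F s + F (flipCoord j s)) := Finset.sum_le_sum fun s _ => hpair s
      -- The flip permutes the vertices, so both summands have the same total.
      _ = 2 * ∑ s, F s := by
        rw [Finset.sum_add_distrib, Equiv.sum_comp (flipCoord j) F, two_mul]
  rw [mul_left_comm, ENNReal.mul_le_mul_iff_right (by simp) (by simp)] at hsum
  calc ENNReal.ofReal B = (Fintype.card (Fin n → Bool) : ℝ≥0∞)⁻¹ *
        ((Fintype.card (Fin n → Bool) : ℝ≥0∞) * ENNReal.ofReal B) := by
        rw [← mul_assoc, ENNReal.inv_mul_cancel (by simp) (by simp), one_mul]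
    _ ≤ _ := by gcongr

theorem lintegral_le_of_lpError_le {n m : ℕ} {p E : ℝ} (hp : 0 < p) (hE : 0 ≤ E)
    {M : Mechanism n m} {A : Matrix (Fin m) (Fin n) ℝ} (h : lpError p M A ≤ ENNReal.ofReal E)
    (x : Fin n → ℝ) :
    ∫⁻ y, ENNReal.ofReal (∑ i, |y i - (A *ᵥ x) i| ^ p) ∂(M x : Measure (Fin m → ℝ)) ≤
      ENNReal.ofReal (E ^ p) := by
  have h1 := (le_iSup (fun x : Fin n → ℝ => (∫⁻ y, ENNReal.ofReal (∑ i, |y i - (A *ᵥ x) i| ^ p)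
    ∂(M x : Measure (Fin m → ℝ))) ^ (1 / p)) x).trans h
  have h2 := ENNReal.rpow_le_rpow h1 hp.le
  rwa [← ENNReal.rpow_mul, one_div_mul_cancel hp.ne', ENNReal.rpow_one,
    ENNReal.ofReal_rpow_of_nonneg hE hp.le] at h2

/-- The lower bound obtained from the privacy of groups of size `k`. -/
theorem gammaNorm_mul_le_lpError {n m : ℕ} {p ε δ : ℝ} (hp : 2 ≤ p) (hε : 0 ≤ ε) (hδ : 0 ≤ δ)
    {M : Mechanism n m} (hM : IsDP ε δ M) (A : Matrix (Fin m) (Fin n) ℝ) {k : ℕ} (hk : 0 < k)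
    (hδk : δ * ∑ i ∈ Finset.range k, Real.exp (i * ε) < 1) :
    ENNReal.ofReal (gammaNorm p A * (k * Real.sqrt
      ((1 - δ * ∑ i ∈ Finset.range k, Real.exp (i * ε)) / (8 * Real.exp (k * ε))))) ≤
      lpError p M A := by
  have hp0 : 0 < p := by linarith
  rcases eq_or_ne (lpError p M A) ⊤ with htop | htop
  · rw [htop]
    exact le_top
  set E := (lpError p M A).toReal with hEdef
  have hE : lpError p M A = ENNReal.ofReal E := (ENNReal.ofReal_toReal htop).symm
  have hE0 : 0 ≤ E := ENNReal.toReal_nonneg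
  set q := (1 - δ * ∑ i ∈ Finset.range k, Real.exp (i * ε)) / (8 * Real.exp (k * ε)) with hq
  have hq0 : 0 < q := div_pos (by linarith) (by positivity)
  have hmoment : ∫⁻ z, ENNReal.ofReal (∑ i, |z i| ^ p) ∂(cubeError M A k) ≤
      ENNReal.ofReal (E ^ p) := by
    have hm (i : Fin m) : Measurable fun z : Fin m → ℝ => |z i| ^ p :=
      ((measurable_pi_apply i).abs).pow_const p
    rw [lintegral_cubeError _ _ _ (by fun_prop)]
    exact inv_card_mul_sum_le fun s => lintegral_le_of_lpError_le hp0 hE0 hE.le _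
  have hk0 : (0 : ℝ) < k := Nat.cast_pos.2 hk
  have := gammaNorm_le_of_secondMoment hp (cubeError M A k) hE0 (β := q * k ^ 2) (by positivity)
    hmoment (secondMoment_cubeError_ge hε hδ hM A k)
  rw [hE]
  refine ENNReal.ofReal_le_ofReal ?_
  rw [Real.sqrt_mul hq0.le, Real.sqrt_sq hk0.le, mul_one_div, le_div_iff₀ (by positivity)] at this
  rwa [mul_comm (k : ℝ)]

/-! ### Error and privacy of the matrix mechanism. -/

theorem lpError_matrixMechanism_le {m k n : ℕ} {p σ : ℝ} (hp : 2 ≤ p) (hσ : 0 < σ)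
    (L : Matrix (Fin m) (Fin k) ℝ) (R : Matrix (Fin k) (Fin n) ℝ) :
    lpError p (matrixMechanism L R σ) (L * R) ≤
      ENNReal.ofReal (Real.sqrt p * σ * Real.sqrt (pTrace (p / 2) (L * Lᵀ))) := by
  have hp0 : 0 < p := by linarith
  refine iSup_le fun x => ?_
  have hdiag := mul_transpose_diag_nonneg L
  have hT : 0 ≤ ∑ i, (L * Lᵀ) i i ^ (p / 2) :=
    Finset.sum_nonneg fun i _ => Real.rpow_nonneg (hdiag i) _
  have hmeas (i : Fin m) : Measurable fun y : Fin m → ℝ => |y i - ((L * R) *ᵥ x) i| ^ p :=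
    (((measurable_pi_apply i).sub_const _).abs).pow_const p
  have hcont : Measurable fun z : Fin k → ℝ => L *ᵥ (R *ᵥ x + z) :=
    (Continuous.matrix_mulVec continuous_const (continuous_const.add continuous_id)).measurable
  have hmoment : ∫⁻ y, ENNReal.ofReal (∑ i, |y i - ((L * R) *ᵥ x) i| ^ p)
      ∂(matrixMechanism L R σ x : Measure (Fin m → ℝ)) ≤
      ENNReal.ofReal ((Real.sqrt p * σ) ^ p * ∑ i, (L * Lᵀ) i i ^ (p / 2)) := by
    change ∫⁻ y, ENNReal.ofReal (∑ i, |y i - ((L * R) *ᵥ x) i| ^ p)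
      ∂((gaussianVector k σ).map fun z => L *ᵥ (R *ᵥ x + z)) ≤ _
    rw [lintegral_map (Finset.measurable_sum _ fun i _ => hmeas i).ennreal_ofReal hcont]
    have hpt (z : Fin k → ℝ) : ENNReal.ofReal
        (∑ i, |(L *ᵥ (R *ᵥ x + z)) i - ((L * R) *ᵥ x) i| ^ p) =
        ∑ i, ENNReal.ofReal (|L i ⬝ᵥ z| ^ p) := by
      rw [← ENNReal.ofReal_sum_of_nonneg fun i _ => Real.rpow_nonneg (abs_nonneg _) _]
      congr 1
      refine Finset.sum_congr rfl fun i _ => ?_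
      rw [mulVec_add, mulVec_mulVec, Pi.add_apply, add_sub_cancel_left]
      rfl
    simp_rw [hpt]
    have hm2 (i : Fin m) : Measurable fun z : Fin k → ℝ => ENNReal.ofReal (|L i ⬝ᵥ z| ^ p) := by
      unfold dotProduct
      fun_prop
    rw [lintegral_finsetSum _ fun i _ => hm2 i, Finset.mul_sum, ENNReal.ofReal_sum_of_nonneg
      fun i _ => mul_nonneg (by positivity) (Real.rpow_nonneg (hdiag i) _)]
    exact Finset.sum_le_sum fun i _ => lintegral_abs_dotProduct_rpow_le hσ hp (L i)
  refine (ENNReal.rpow_le_rpow hmoment (by positivity)).trans (le_of_eq ?_)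
  rw [ENNReal.ofReal_rpow_of_nonneg (by positivity) (by positivity)]
  congr 1
  rw [Real.mul_rpow (by positivity) hT, ← Real.rpow_mul (by positivity),
    mul_one_div_cancel hp0.ne', Real.rpow_one, pTrace, Real.sqrt_eq_rpow (_ ^ _),
    ← Real.rpow_mul hT]
  congr 2
  field_simp

/-- Post-processing: pulling the event back along `w ↦ L (R x' + w)` reduces the comparison to `N(0,
σ² I)` against its shift by `R (x - x')`, whose length is at most `‖R‖_{1→2}`. -/
theorem isDP_matrixMechanism {m k n : ℕ} {ε δ σ : ℝ} (hε : 0 < ε) (hε1 : ε < 1) (hδ : 0 < δ)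
    (hδ2 : δ ≤ 1 / 2) (L : Matrix (Fin m) (Fin k) ℝ) (R : Matrix (Fin k) (Fin n) ℝ) (hσ : 0 < σ)
    (h : oneTwoNorm R ^ 2 / σ ^ 2 ≤ max ε δ ^ 2 / (4 * Real.log (1 / δ))) :
    IsDP ε δ (matrixMechanism L R σ) := by
  intro x x' hxx S hS
  set T : Set (Fin k → ℝ) := (fun w => L *ᵥ (R *ᵥ x' + w)) ⁻¹' S with hT
  have hmeas (y : Fin n → ℝ) : Measurable fun z : Fin k → ℝ => L *ᵥ (R *ᵥ y + z) :=
    (Continuous.matrix_mulVec continuous_const (continuous_const.add continuous_id)).measurable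
  have hTm : MeasurableSet T := hmeas x' hS
  have e1 : (matrixMechanism L R σ x : Measure (Fin m → ℝ)) S =
      (gaussianVector k σ).map (fun z => R *ᵥ (x - x') + z) T := by
    change ((gaussianVector k σ).map fun z => L *ᵥ (R *ᵥ x + z)) S = _
    rw [Measure.map_apply (hmeas x) hS, Measure.map_apply (by fun_prop) hTm]
    congr 1
    ext z
    simp only [hT, Set.mem_preimage, mulVec_sub]
    rw [← add_assoc, add_sub_cancel]
  have e2 : (matrixMechanism L R σ x' : Measure (Fin m → ℝ)) S = gaussianVector k σ T := by
    change ((gaussianVector k σ).map fun z => L *ᵥ (R *ᵥ x' + z)) S = _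
    rw [Measure.map_apply (hmeas x') hS]
  rw [e1, e2]
  have hv : (R *ᵥ (x - x')) ⬝ᵥ (R *ᵥ (x - x')) / σ ^ 2 ≤
      max ε δ ^ 2 / (4 * Real.log (1 / δ)) := by
    refine le_trans ?_ h
    gcongr
    have := sqrt_sum_sq_mulVec_le_oneTwoNorm R (x := x - x') hxx
    have := (Real.sqrt_le_left (oneTwoNorm_nonneg R)).1 this
    simpa [dotProduct, sq] using this
  rcases le_total δ ε with hle | hle
  · rw [max_eq_left hle] at hv
    exact gaussianVector_shift_le_of_le hσ hε hε1 hδ hδ2 _ hv hTm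
  · rw [max_eq_right hle] at hv
    refine (gaussianVector_shift_le_add hσ hδ hδ2 _ hv hTm).trans ?_
    gcongr
    exact Real.one_le_exp hε.le

/-! ### Lower bounds by choice of the group size. -/

theorem half_le_floor {y : ℝ} (hy : 1 ≤ y) : 0 < ⌊y⌋₊ ∧ y / 2 ≤ ⌊y⌋₊ := by
  have h1 : 1 ≤ ⌊y⌋₊ := Nat.one_le_floor_iff y |>.2 hy
  have h2 := Nat.lt_floor_add_one y
  have h3 : (1 : ℝ) ≤ ⌊y⌋₊ := by exact_mod_cast h1
  exact ⟨h1, by linarith⟩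

theorem lpError_ge_of_deltaTilde {m n : ℕ} (A : Matrix (Fin m) (Fin n) ℝ) {p ε δ : ℝ} (hp : 2 ≤ p)
    (hε : 0 < ε) (hε2 : ε < 1 / 2) (hδ : 0 ≤ δ) {M : Mechanism n m} (hM : IsDP ε δ M) :
    ENNReal.ofReal ((1 - deltaTilde ε δ) * gammaNorm p A / (200 * ε)) ≤ lpError p M A := by
  have hγ := gammaNorm_nonneg p A
  rcases le_or_gt 1 (deltaTilde ε δ) with h1 | h1
  · rw [ENNReal.ofReal_of_nonpos]
    · exact zero_le
    · exact div_nonpos_of_nonpos_of_nonneg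
        (mul_nonpos_of_nonpos_of_nonneg (by linarith) hγ) (by positivity)
  -- Groups of size about `1/(2ε)` keep `e^(kε) ≤ e^(1/2) ≤ 2`, and `ε < 1/2` ensures `k ≥ 1`. The
  -- numerator `e^(1/2) - 1` of `δ̃` comes from the resulting geometric sum; its factor `2 e^(2ε)`
  -- is slack here.
  obtain ⟨hk, hk2⟩ := half_le_floor (y := 1 / (2 * ε)) (by rw [le_div_iff₀] <;> linarith)
  have hk3 : (⌊1 / (2 * ε)⌋₊ : ℝ) ≤ 1 / (2 * ε) := Nat.floor_le (by positivity)
  set k := ⌊1 / (2 * ε)⌋₊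
  have hkε : k * ε ≤ 1 / 2 := by
    calc k * ε ≤ 1 / (2 * ε) * ε := by gcongr
      _ = 1 / 2 := by field_simp
  have hexp : 1 < Real.exp ε := Real.one_lt_exp_iff.2 hε
  have hexp2 : Real.exp (1 / 2) ≤ 2 := by
    rw [← Real.le_log_iff_exp_le (by norm_num)]
    linarith [Real.log_two_gt_d9]
  have hgeom : ∑ i ∈ Finset.range k, Real.exp (i * ε) ≤
      (Real.exp (1 / 2) - 1) / (Real.exp ε - 1) := by
    simp_rw [Real.exp_nat_mul]
    rw [geom_sum_eq hexp.ne', ← Real.exp_nat_mul]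
    have : 0 < Real.exp ε - 1 := by linarith
    gcongr
  have hδk : δ * ∑ i ∈ Finset.range k, Real.exp (i * ε) ≤ deltaTilde ε δ := by
    have h0 : 0 ≤ ∑ i ∈ Finset.range k, Real.exp (i * ε) :=
      Finset.sum_nonneg fun _ _ => (Real.exp_pos _).le
    have h2 : 1 ≤ 2 * Real.exp (2 * ε) := by
      linarith [Real.one_le_exp (by positivity : 0 ≤ 2 * ε)]
    calc δ * ∑ i ∈ Finset.range k, Real.exp (i * ε)
        ≤ 2 * Real.exp (2 * ε) * (δ * ((Real.exp (1 / 2) - 1) / (Real.exp ε - 1))) :=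
          (mul_le_mul_of_nonneg_left hgeom hδ).trans
            (le_mul_of_one_le_left (mul_nonneg hδ (h0.trans hgeom)) h2)
      _ = deltaTilde ε δ := by rw [deltaTilde]; ring
  refine le_trans (ENNReal.ofReal_le_ofReal ?_)
    (gammaNorm_mul_le_lpError hp hε.le hδ hM A hk (hδk.trans_lt h1))
  have hd0 : 0 ≤ deltaTilde ε δ :=
    le_trans (mul_nonneg hδ (Finset.sum_nonneg fun _ _ => (Real.exp_pos _).le)) hδk
  have hsqrt : (1 - deltaTilde ε δ) / 4 ≤ Real.sqrt
      ((1 - δ * ∑ i ∈ Finset.range k, Real.exp (i * ε)) / (8 * Real.exp (k * ε))) := by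
    refine Real.le_sqrt_of_sq_le ?_
    -- Since `0 ≤ 1 - δ̃ ≤ 1`, squaring only decreases it, so the square root can be traded for a
    -- linear factor.
    calc ((1 - deltaTilde ε δ) / 4) ^ 2 ≤ (1 - deltaTilde ε δ) / (8 * 2) := by nlinarith
      _ ≤ _ := by
        have : Real.exp (k * ε) ≤ 2 := (Real.exp_le_exp.2 hkε).trans hexp2
        gcongr
        linarith
  calc (1 - deltaTilde ε δ) * gammaNorm p A / (200 * ε)
      ≤ (1 - deltaTilde ε δ) * gammaNorm p A / (16 * ε) := by
        have : 0 ≤ 1 - deltaTilde ε δ := by linarith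
        gcongr
        norm_num
    _ = gammaNorm p A * (1 / (2 * ε) / 2 * ((1 - deltaTilde ε δ) / 4)) := by field_simp; ring
    _ ≤ _ := by
        have : 0 ≤ (1 - deltaTilde ε δ) / 4 := by linarith
        gcongr

theorem lpError_ge_of_group {m n : ℕ} (A : Matrix (Fin m) (Fin n) ℝ) {p ε δ : ℝ} (hp : 2 ≤ p)
    (hε : 0 < ε) (hδ : 0 ≤ δ) {M : Mechanism n m} (hM : IsDP ε δ M) {k : ℕ} (hk : 0 < k)
    (hkε : k * ε ≤ 1) (hδk : δ * ∑ i ∈ Finset.range k, Real.exp (i * ε) ≤ 1 / 2) :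
    ENNReal.ofReal (gammaNorm p A * (k / 7)) ≤ lpError p M A := by
  have hγ := gammaNorm_nonneg p A
  refine le_trans (ENNReal.ofReal_le_ofReal ?_)
    (gammaNorm_mul_le_lpError hp hε.le hδ hM A hk (by linarith))
  rw [div_eq_mul_one_div]
  gcongr
  refine Real.le_sqrt_of_sq_le ?_
  -- The constant `7` works because `16 e < 49`.
  rw [le_div_iff₀ (by positivity)]
  have : Real.exp (k * ε) ≤ Real.exp 1 := Real.exp_le_exp.2 hkε
  linarith [Real.exp_one_lt_d9]

/-- The group size must satisfy both `k ε ≲ 1` and `k δ ≲ 1`, hence `k` of order `1 / max ε δ`. The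
constant is `84 = 12 · 7`. -/
theorem lpError_ge_div_max {m n : ℕ} (A : Matrix (Fin m) (Fin n) ℝ) {p ε δ : ℝ} (hp : 2 ≤ p)
    (hε : 0 < ε) (hε1 : ε < 1) (hδ : 0 < δ) (hδ2 : δ ≤ 1 / 2) {M : Mechanism n m}
    (hM : IsDP ε δ M) :
    ENNReal.ofReal (gammaNorm p A / (84 * max ε δ)) ≤ lpError p M A := by
  have hγ := gammaNorm_nonneg p A
  set η := max ε δ
  have hη : 0 < η := lt_max_of_lt_left hε
  have hεη : ε ≤ η := le_max_left _ _
  have hδη : δ ≤ η := le_max_right _ _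
  suffices H : ∃ k : ℕ, 0 < k ∧ 1 / (12 * η) ≤ k ∧ k * ε ≤ 1 ∧
      δ * ∑ i ∈ Finset.range k, Real.exp (i * ε) ≤ 1 / 2 by
    obtain ⟨k, hk, hk2, hkε, hδk⟩ := H
    refine le_trans (ENNReal.ofReal_le_ofReal ?_) (lpError_ge_of_group A hp hε hδ.le hM hk hkε hδk)
    calc gammaNorm p A / (84 * η) = gammaNorm p A * (1 / (12 * η) / 7) := by field_simp; ring
      _ ≤ _ := by gcongr
  -- For large `η` a single step suffices; otherwise `k ≈ 1/(6η)`, and `δ k e ≤ e/6 ≤ 1/2`.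
  rcases le_or_gt (1 / 12) η with h | h
  · refine ⟨1, one_pos, ?_, by simpa using hε1.le, by simpa using hδ2⟩
    rw [Nat.cast_one, div_le_one (by positivity)]
    linarith
  · obtain ⟨hk, hk2⟩ := half_le_floor (y := 1 / (6 * η)) (by rw [le_div_iff₀] <;> linarith)
    have hk3 : (⌊1 / (6 * η)⌋₊ : ℝ) ≤ 1 / (6 * η) := Nat.floor_le (by positivity)
    set k := ⌊1 / (6 * η)⌋₊
    have hkη : k * η ≤ 1 / 6 := by
      calc k * η ≤ 1 / (6 * η) * η := by gcongr
        _ = 1 / 6 := by field_simp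
    have hkε : k * ε ≤ 1 := by
      have : k * ε ≤ k * η := by gcongr
      linarith
    refine ⟨k, hk, ?_, hkε, ?_⟩
    · refine le_trans (le_of_eq ?_) hk2
      field_simp
      norm_num
    · have hsum : ∑ i ∈ Finset.range k, Real.exp (i * ε) ≤ k * Real.exp 1 := by
        calc ∑ i ∈ Finset.range k, Real.exp (i * ε) ≤ ∑ _i ∈ Finset.range k, Real.exp 1 := by
              refine Finset.sum_le_sum fun i hi => Real.exp_le_exp.2 (le_trans ?_ hkε)
              have : (i : ℝ) ≤ k := by exact_mod_cast (Finset.mem_range.1 hi).le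
              gcongr
          _ = _ := by simp
      calc δ * ∑ i ∈ Finset.range k, Real.exp (i * ε) ≤ η * (k * Real.exp 1) := by gcongr
        _ = k * η * Real.exp 1 := by ring
        _ ≤ 1 / 6 * Real.exp 1 := by gcongr
        _ ≤ 1 / 2 := by linarith [Real.exp_one_lt_d9]

/-! ### The zero matrix and the main theorem. -/

/-- Inner dimension zero makes the output independent of the input, so no positivity of the noise is
needed. This handles `A = 0`. -/
theorem isDP_matrixMechanism_zero {m n : ℕ} {ε δ : ℝ} (hε : 0 ≤ ε)
    (L : Matrix (Fin m) (Fin 0) ℝ) (R : Matrix (Fin 0) (Fin n) ℝ) (σ : ℝ) :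
    IsDP ε δ (matrixMechanism L R σ) := by
  intro x x' _ S _
  have : matrixMechanism L R σ x = matrixMechanism L R σ x' := by
    have h : R *ᵥ x = R *ᵥ x' := Subsingleton.elim _ _
    apply Subtype.ext
    simp only [matrixMechanism, h]
  rw [this]
  refine le_add_right (le_mul_of_one_le_left zero_le ?_)
  simpa using Real.one_le_exp hε

theorem lpError_matrixMechanism_zero {m n : ℕ} {p : ℝ} (hp : 0 < p)
    (L : Matrix (Fin m) (Fin 0) ℝ) (R : Matrix (Fin 0) (Fin n) ℝ) (σ : ℝ) :
    lpError p (matrixMechanism L R σ) 0 = 0 := by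
  refine le_antisymm (iSup_le fun x => ?_) zero_le
  have hmeas (i : Fin m) : Measurable fun y : Fin m → ℝ =>
      |y i - ((0 : Matrix (Fin m) (Fin n) ℝ) *ᵥ x) i| ^ p :=
    (((measurable_pi_apply i).sub_const _).abs).pow_const p
  change (∫⁻ y, ENNReal.ofReal (∑ i, |y i - ((0 : Matrix (Fin m) (Fin n) ℝ) *ᵥ x) i| ^ p)
      ∂((gaussianVector 0 σ).map fun z => L *ᵥ (R *ᵥ x + z))) ^ (1 / p) ≤ 0
  have hcont : Measurable fun z : Fin 0 → ℝ => L *ᵥ (R *ᵥ x + z) :=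
    (Continuous.matrix_mulVec continuous_const (continuous_const.add continuous_id)).measurable
  rw [lintegral_map (Finset.measurable_sum _ fun i _ => hmeas i).ennreal_ofReal hcont]
  simp [mulVec, dotProduct, Real.zero_rpow hp.ne', hp]

theorem mainTheorem1 :
    ∃ C : ℝ, 0 < C ∧
      (∀ (m n : ℕ) (A : Matrix (Fin m) (Fin n) ℝ) (p ε δ : ℝ),
        2 ≤ p → 0 < ε → ε < 1 / 2 → 0 ≤ δ → δ ≤ 1 →
        ∀ M : Mechanism n m, IsDP ε δ M →
          ENNReal.ofReal ((1 - deltaTilde ε δ) * gammaNorm p A / (C * ε)) ≤ lpError p M A) ∧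
      (∀ ε δ : ℝ, 0 < ε → ε < 1 → 0 < δ → δ ≤ 1 / 2 →
        ∃ c : ℝ, 0 < c ∧
          ∀ (m n : ℕ) (A : Matrix (Fin m) (Fin n) ℝ) (p : ℝ), 2 ≤ p →
            ∃ (k : ℕ) (L : Matrix (Fin m) (Fin k) ℝ) (R : Matrix (Fin k) (Fin n) ℝ),
              L * R = A ∧
              IsDP ε δ (matrixMechanism L R (c * oneTwoNorm R)) ∧
              lpError p (matrixMechanism L R (c * oneTwoNorm R)) A ≤
                ENNReal.ofReal
                  (3 * gammaNorm p A * Real.sqrt (p * Real.log (1 / δ) / (2 * ε ^ 2))) ∧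
              ∀ M : Mechanism n m, IsDP ε δ M →
                lpError p (matrixMechanism L R (c * oneTwoNorm R)) A ≤
                  ENNReal.ofReal (C * Real.sqrt (p * Real.log (1 / δ))) * lpError p M A) := by
  refine ⟨200, by norm_num, fun m n A p ε δ hp hε hε2 hδ _ M hM =>
    lpError_ge_of_deltaTilde A hp hε hε2 hδ hM, fun ε δ hε hε1 hδ hδ2 => ?_⟩
  set l := Real.log (1 / δ) with hl
  have hl0 : 0 < l := Real.log_pos (by rw [lt_div_iff₀ hδ]; linarith)
  set η := max ε δ with hη
  have hη0 : 0 < η := lt_max_of_lt_left hε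
  refine ⟨2 * Real.sqrt l / η, by positivity, fun m n A p hp => ?_⟩
  have hp0 : 0 < p := by linarith
  rcases (gammaNorm_nonneg p A).eq_or_lt with hγ | hγ
  · have hA : A = 0 := by
      ext i j
      have := abs_entry_le_gammaNorm hp0 A i j
      rw [← hγ] at this
      exact abs_nonpos_iff.1 this
    subst hA
    refine ⟨0, 0, 0, by simp, isDP_matrixMechanism_zero hε.le _ _ _, ?_, fun M _ => ?_⟩ <;>
    · rw [lpError_matrixMechanism_zero hp0]
      exact zero_le
  -- Attainment of the infimum is not needed: both target constants leave room for a relative loss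
  -- of `1/20`. This requires `γ > 0`, which is why `A = 0` was split off.
  obtain ⟨k, L, R, rfl, hLR⟩ := exists_factorization_lt
    (show gammaNorm p A < 21 / 20 * gammaNorm p A by linarith)
  have hR : 0 < oneTwoNorm R := by
    refine (oneTwoNorm_nonneg R).lt_of_ne fun h => ?_
    have := hγ.trans_le (gammaNorm_le p L R)
    rw [← h, mul_zero] at this
    exact this.false
  set γ := gammaNorm p (L * R) with hγdef
  have hσ : 0 < 2 * Real.sqrt l / η * oneTwoNorm R := by positivity
  have herr : lpError p (matrixMechanism L R (2 * Real.sqrt l / η * oneTwoNorm R)) (L * R) ≤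
      ENNReal.ofReal (21 / 10 * (Real.sqrt (p * l) * γ / η)) := by
    refine (lpError_matrixMechanism_le hp hσ L R).trans (ENNReal.ofReal_le_ofReal ?_)
    calc Real.sqrt p * (2 * Real.sqrt l / η * oneTwoNorm R) *
          Real.sqrt (pTrace (p / 2) (L * Lᵀ))
        = Real.sqrt p * (2 * Real.sqrt l / η) *
          (Real.sqrt (pTrace (p / 2) (L * Lᵀ)) * oneTwoNorm R) := by ring
      _ ≤ Real.sqrt p * (2 * Real.sqrt l / η) * (21 / 20 * γ) := by gcongr
      _ = _ := by rw [Real.sqrt_mul hp0.le]; ring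
  refine ⟨k, L, R, rfl, isDP_matrixMechanism hε hε1 hδ hδ2 L R hσ (le_of_eq ?_),
    herr.trans (ENNReal.ofReal_le_ofReal ?_), fun M hM => herr.trans ?_⟩
  · rw [mul_pow, div_pow, mul_pow, Real.sq_sqrt hl0.le, ← hl, ← hη]
    field_simp
    norm_num
  -- Here `7/10 < 1/√2` and `3 · 7/10 = 21/10`, exactly the constant in `herr`.
  · have h1 : 7 / 10 * (Real.sqrt (p * l) / ε) ≤ Real.sqrt (p * l / (2 * ε ^ 2)) := by
      refine Real.le_sqrt_of_sq_le ?_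
      rw [mul_pow, div_pow (Real.sqrt _), Real.sq_sqrt (by positivity)]
      have : 0 < p * l / ε ^ 2 := by positivity
      have e : p * l / (2 * ε ^ 2) = 1 / 2 * (p * l / ε ^ 2) := by field_simp
      rw [e]
      nlinarith
    calc 21 / 10 * (Real.sqrt (p * l) * γ / η) ≤ 21 / 10 * (Real.sqrt (p * l) * γ / ε) := by
          gcongr
          exact le_max_left _ _
      _ = 3 * γ * (7 / 10 * (Real.sqrt (p * l) / ε)) := by ring
      _ ≤ _ := by gcongr
  -- The lower bound has the same `γ / max ε δ`, so only `21/10 ≤ 200/84` remains.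
  · refine le_trans ?_ (mul_le_mul_right (lpError_ge_div_max (L * R) hp hε hε1 hδ hδ2 hM) _)
    rw [← ENNReal.ofReal_mul (by positivity)]
    refine ENNReal.ofReal_le_ofReal ?_
    have : 0 ≤ Real.sqrt (p * l) * γ / η := by positivity
    have e : 200 * Real.sqrt (p * l) * (γ / (84 * η)) =
        200 / 84 * (Real.sqrt (p * l) * γ / η) := by field_simp
    rw [← hγdef, ← hη, e]
    linarith
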